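/- Let $p$ be a prime and let $K$ be a finite extension of $\mathbb{Q}_p$ with ring of integers $\mathcal{O}_K$, maximal ideal $\mathfrak{m}_K$ and residue field $k$. Let $\mathcal{E} \subset \mathbb{P}^2_{\mathcal{O}_K}$ be the projective curve given by a Weierstrass equation $$y^2 + a_1xy + a_3y = x^3 + a_2x^2 + a_4x + a_6, \qquad a_1,a_2,a_3,a_4,a_6 \in \mathfrak{m}_K,$$ whose generic fibre is an elliptic curve with origin $(0:1:0)$. Give $\mathcal{E}(K) \subset \mathbb{P}^2(K)$ the subspace topology, and let $\mathcal{E}_0(K) \subset \mathcal{E}(K)$ be the set of points that reduce to a nonsingular point of the special fibre $\mathcal{E}_k$. Let $F(X,Y) = \sum_{i,j} c_{ij}X^iY^j \in \mathcal{O}_K[[X,Y]]$ be the formal group law of $\mathcal{E}$ with respect to the parameter $z=-x/y$ at the origin. The set $\mathcal{E}_0(K)$ is a subgroup of $\mathcal{E}(K)$ and a topological group. For all $u,v \in \mathcal{O}_K$ the series $F(u,v) = \sum_{i,j} c_{ij}u^iv^j$ converges in $\mathcal{O}_K$, and $u +_F v := F(u,v)$ makes the topological space $\mathcal{O}_K$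 into an abelian topological group, denoted $\widehat{\mathcal{E}}(\mathcal{O}_K)$. Moreover: 1. Every affine point $(x,y) \in \mathcal{E}_0(K)$ has $y \neq 0$, and the map $\Psi : \mathcal{E}_0(K) \to \widehat{\mathcal{E}}(\mathcal{O}_K)$ given by $\Psi(x,y) = -x/y$ and $\Psi(0:1:0) = 0$ is well defined and an isomorphism of topological groups. 2. If $6\,e(K/\mathbb{Q}_p) < p-1$, where $e(K/\mathbb{Q}_p)$ denotes the ramification index, then $\mathcal{E}_0(K)$ is topologically isomorphic to the additive group $\mathcal{O}_K$ with its usual topology and group structure. -/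

import Mathlib

noncomputable section

/-! ### The ring of integers of a finite extension of `ℚ_[p]` -/

/-- The ring of integers of a `p`-adic field `K`, as the valuation ring `{x | ‖x‖ ≤ 1}`. -/
def padicIntegers (p : ℕ) [Fact p.Prime] (K : Type*) [NormedField K] [NormedAlgebra ℚ_[p] K] :
    ValuationSubring K where
  carrier := {x | ‖x‖ ≤ 1}
  zero_mem' := by simp
  one_mem' := by simp
  neg_mem' := fun {x} (hx : ‖x‖ ≤ 1) => show ‖-x‖ ≤ 1 by simpa using hx
  mul_mem' := fun {x y} (hx : ‖x‖ ≤ 1) (hy : ‖y‖ ≤ 1) => show ‖x * y‖ ≤ 1 by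
    rw [norm_mul]; exact mul_le_one₀ hx (norm_nonneg y) hy
  add_mem' := fun {x y} (hx : ‖x‖ ≤ 1) (hy : ‖y‖ ≤ 1) => show ‖x + y‖ ≤ 1 by
    have : IsUltrametricDist K := IsUltrametricDist.of_normedAlgebra ℚ_[p]
    exact (IsUltrametricDist.norm_add_le_max x y).trans (max_le hx hy)
  mem_or_inv_mem' := fun x => show ‖x‖ ≤ 1 ∨ ‖x⁻¹‖ ≤ 1 by
    rcases le_total ‖x‖ 1 with h | h
    · exact Or.inl h
    · exact Or.inr (by rw [norm_inv]; exact inv_le_one_of_one_le₀ h)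

/-- The structure map from `ℤ_[p]` to the ring of integers of `K`. -/
instance padicIntegers.instAlgebra (p : ℕ) [Fact p.Prime] (K : Type*) [NormedField K]
    [NormedAlgebra ℚ_[p] K] : Algebra ℤ_[p] (padicIntegers p K) :=
  (((algebraMap ℚ_[p] K).comp (algebraMap ℤ_[p] ℚ_[p])).codRestrict (padicIntegers p K)
    (fun x => show ‖algebraMap ℚ_[p] K (x : ℚ_[p])‖ ≤ 1 by
      rw [norm_algebraMap']; exact x.2)).toAlgebra

/-- The ramification index `e(K/ℚ_p)`: the largest `n` with `p 𝓞_K ⊆ 𝔪_K ^ n`. -/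
def padicRamificationIdx (p : ℕ) [Fact p.Prime] (K : Type*) [NormedField K]
    [NormedAlgebra ℚ_[p] K] : ℕ :=
  Ideal.ramificationIdx' (IsLocalRing.maximalIdeal ℤ_[p])
    (IsLocalRing.maximalIdeal (padicIntegers p K))

namespace WeierstrassCurve

/-! ### The topology on the points, the parameter `-x/y` and good points -/

section Points

variable {F : Type*} [Field F] {V : WeierstrassCurve F}

/-- Homogeneous coordinates of a point: `(0 : 1 : 0)` for the origin, `(x : y : 1)` otherwise. -/
def pointCoords : V.toAffine.Point → Fin 3 → F
  | .zero => ![0, 1, 0]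
  | .some x y _ => ![x, y, 1]

theorem pointCoords_ne_zero (P : V.toAffine.Point) : pointCoords P ≠ 0 := by
  cases P with
  | zero => intro h; simpa [pointCoords] using congrFun h 1
  | some x y h => intro h; simpa [pointCoords] using congrFun h 2

/-- The points of the curve as a subset of `ℙ²(F)`, where `ℙ²(F)` is the quotient of
`F³ \ {0}` by scalars. -/
def pointToProj (P : V.toAffine.Point) : Projectivization F (Fin 3 → F) :=
  Projectivization.mk F (pointCoords P) (pointCoords_ne_zero P)

/-- The subspace topology from `ℙ²(F)`, which carries the quotient topology of `F³ \ {0}`. -/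
instance pointTopology [TopologicalSpace F] : TopologicalSpace V.toAffine.Point :=
  TopologicalSpace.induced pointToProj
    (TopologicalSpace.coinduced
      (fun v : {v : Fin 3 → F // v ≠ 0} => Projectivization.mk F v.1 v.2) inferInstance)

/-- The function `-x/y`, with value `0` at the origin. -/
def zParam : V.toAffine.Point → F
  | .zero => 0
  | .some x y _ => -x / y

end Points

/-- For a Weierstrass equation over a local ring `R` inside a field `K`, the set of `K`-points
that have homogeneous coordinates in `R`, not all in the maximal ideal, whose reduction is a
nonsingular point of the reduced projective curve. -/
def nonsingularReduction {R : Type*} [CommRing R] [IsLocalRing R] (W : WeierstrassCurve R)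
    (K : Type*) [Field K] [Algebra R K] : Set (W.baseChange K).toAffine.Point :=
  {P | ∃ v : Fin 3 → R, (∃ i, IsUnit (v i)) ∧
    (∃ c : Kˣ, ∀ i, algebraMap R K (v i) = c * pointCoords P i) ∧
    (W.map (IsLocalRing.residue R)).toProjective.Nonsingular
      (fun i => IsLocalRing.residue R (v i))}

/-! ### The formal group law -/

section Formal

variable {R : Type*} [CommRing R] (W : WeierstrassCurve R)

/-- In the coordinates `z = -x/y`, `w = -1/y` the Weierstrass equation reads `w = f(z, w)`;
this is the map `w ↦ f(z, w)` on power series in `z`. -/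
def formalStep (w : PowerSeries R) : PowerSeries R :=
  PowerSeries.X ^ 3 + PowerSeries.C W.a₁ * PowerSeries.X * w
    + PowerSeries.C W.a₂ * PowerSeries.X ^ 2 * w + PowerSeries.C W.a₃ * w ^ 2
    + PowerSeries.C W.a₄ * PowerSeries.X * w ^ 2 + PowerSeries.C W.a₆ * w ^ 3

/-- The power series `w(z) = z³ + a₁ z⁴ + (a₁² + a₂) z⁵ + ⋯` with `w = f(z, w)`, as the limit of
the iterates of `w ↦ f(z, w)` starting from `0`. The coefficient of `zⁿ` is constant from the
`n`-th iterate on. -/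
def formalW : PowerSeries R :=
  PowerSeries.mk fun n => PowerSeries.coeff n (W.formalStep^[n] 0)

/-- The slope `λ = (w(z₂) - w(z₁)) / (z₂ - z₁)`: if `w = ∑ Aₙ zⁿ`, the coefficient of
`z₁ⁱ z₂ʲ` is `A_{i+j+1}`. -/
def formalSlope : MvPowerSeries (Fin 2) R :=
  fun m => PowerSeries.coeff (m 0 + m 1 + 1) W.formalW

/-- The intercept `ν = w(z₁) - λ z₁` of the line `w = λ z + ν`. -/
def formalIntercept : MvPowerSeries (Fin 2) R :=
  W.formalW.subst (MvPowerSeries.X 0 : MvPowerSeries (Fin 2) R)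
    - W.formalSlope * MvPowerSeries.X 0

/-- The `z`-coordinate `z₃` of the third intersection point of the curve `w = f(z, w)` with the
line `w = λ z + ν`: minus the quotient of the coefficients of `z²` and `z³` in
`f(z, λ z + ν)` is the sum of the three roots. -/
def formalThird : MvPowerSeries (Fin 2) R :=
  let s := W.formalSlope
  let t := W.formalIntercept
  let C : R →+* MvPowerSeries (Fin 2) R := MvPowerSeries.C;
  (-MvPowerSeries.X 0 - MvPowerSeries.X 1
    - (C W.a₁ * s + C W.a₂ * t + C W.a₃ * s ^ 2 + 2 * C W.a₄ * s * t + 3 * C W.a₆ * s ^ 2 * t)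
      * MvPowerSeries.invOfUnit (1 + C W.a₂ * s + C W.a₄ * s ^ 2 + C W.a₆ * s ^ 3) 1)

/-- The formal group law `F(z₁, z₂)` of the curve: the `z`-coordinate of the inverse of the third
intersection point `(z₃, w₃)`, where `w₃ = λ z₃ + ν` and the inverse of the point with
coordinates `(z, w)` has `z`-coordinate `-z / (1 - a₁ z - a₃ w)`. -/
def formalGroupLaw : MvPowerSeries (Fin 2) R :=
  let z := W.formalThird
  let w := W.formalSlope * z + W.formalIntercept
  let C : R →+* MvPowerSeries (Fin 2) R := MvPowerSeries.C;
  (-z * MvPowerSeries.invOfUnit (1 - C W.a₁ * z - C W.a₃ * w) 1)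

/-- The family of terms `c_{ij} uⁱ vʲ` of the series `F(u, v)`. -/
def formalGroupTerms (u v : R) (m : Fin 2 →₀ ℕ) : R :=
  MvPowerSeries.coeff m W.formalGroupLaw * u ^ m 0 * v ^ m 1

/-- The set `R`, as the carrier of the group whose law is given by `F`. It is a copy of `R`
without the algebraic structure of `R`. -/
def FormalPoints {R : Type*} [CommRing R] (_W : WeierstrassCurve R) : Type _ := R

/-- The element of `R` underlying an element of `FormalPoints W`. -/
def FormalPoints.val {W : WeierstrassCurve R} (u : W.FormalPoints) : R := u

instance FormalPoints.instTopologicalSpace [TopologicalSpace R] :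
    TopologicalSpace W.FormalPoints :=
  inferInstanceAs (TopologicalSpace R)

end Formal

end WeierstrassCurve

end

/-! In the coordinates z = -x/y, w = -1/y the curve reads w = f(z, w), which is homogeneous when z,
w, aᵢ get weights -1, -3, i. Choose r < 1 such that r ^ 6 is the norm of a uniformizer. As each aᵢ
lies in the maximal ideal and i ≤ 6, ‖aᵢ‖ ≤ r ^ i. Homogeneity then bounds the degree-n coefficients
of w(z) by r ^ (n - 3) and those of F by r ^ (n - 1), so these series converge on all of 𝓞_K and not
only on the maximal ideal (`CoeffBound.formalGroupLaw`).

For fixed z the map w ↦ f(z, w) contracts by r, so w(z) is the only integral solution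
(`CoeffBound.eq_of_zwEquation`). The reduced curve is the cusp y² = x³, whose nonsingular points are
those with Y ≠ 0. Hence z ↦ (z : -1 : w(z)) is a bijection from 𝓞_K onto the points of good
reduction (`coe_goodPoints`). Evaluating the formal chord identities and comparing with the
chord-tangent law shows that it carries F to addition (`pointOf_add`). The group axioms for F are
therefore inherited from the curve.

For the second claim, expand [p](t) by Newton's forward differences: the k-th difference of the
coordinate at 0 is at most r ^ (k - 1) ‖t‖ ^ k, and p divides the binomial coefficients with 0 < k <
p. Since 6e < p - 1 gives r ^ (p - 1) < |p|, the map [p] is multiplication by p up to a strictly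
smaller error. So [pⁿ](u) / pⁿ converges to an additive map L with ‖L u - u‖ ≤ θ ‖u‖ and θ < 1
(`exists_log`). Such a map is injective, and compactness makes it onto and a homeomorphism. -/

noncomputable section

open MvPowerSeries

/-! ### Power series with weighted coefficient bounds -/

namespace MvPowerSeries

variable {σ : Type*} {R : Type*} [NormedCommRing R]

/-- The coefficients of `G` in degree `n` have norm at most `r ^ (n - k)`. -/
def HasWeight (r : ℝ) (k : ℕ) (G : MvPowerSeries σ R) : Prop :=
  ∀ m, ‖coeff m G‖ * r ^ k ≤ r ^ m.degree

variable {r : ℝ} {k l : ℕ} {G H : MvPowerSeries σ R}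

theorem HasWeight.mono (h0 : 0 < r) (h1 : r < 1) (h : HasWeight r k G) (hkl : k ≤ l) :
    HasWeight r l G := fun m =>
  (mul_le_mul_of_nonneg_left (pow_le_pow_of_le_one h0.le h1.le hkl) (norm_nonneg _)).trans (h m)

theorem HasWeight.neg (h : HasWeight r k G) : HasWeight r k (-G) := fun m => by
  simpa using h m

theorem HasWeight.add [IsUltrametricDist R] (h0 : 0 < r) (h : HasWeight r k G)
    (h' : HasWeight r k H) : HasWeight r k (G + H) := fun m => by
  rw [map_add]
  have hle := IsUltrametricDist.norm_add_le_max (coeff m G) (coeff m H)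
  rcases le_max_iff.1 hle with h2 | h2
  · exact (mul_le_mul_of_nonneg_right h2 (by positivity)).trans (h m)
  · exact (mul_le_mul_of_nonneg_right h2 (by positivity)).trans (h' m)

theorem HasWeight.sub [IsUltrametricDist R] (h0 : 0 < r) (h : HasWeight r k G)
    (h' : HasWeight r k H) : HasWeight r k (G - H) := by
  rw [sub_eq_add_neg]; exact h.add h0 h'.neg

theorem hasWeight_zero (h0 : 0 < r) : HasWeight r k (0 : MvPowerSeries σ R) := fun m => by
  simp only [map_zero, norm_zero, zero_mul]; positivity

/-- By the ultrametric inequality a coefficient of the product is bounded by its largest convolution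
term, and in each term the exponents of r add. -/
theorem norm_coeff_mul_le [IsUltrametricDist R] (h0 : 0 < r) (m : σ →₀ ℕ) (k l : ℕ)
    (h : ∀ a b, a + b = m →
      ‖coeff a G‖ * r ^ k ≤ r ^ a.degree ∧ ‖coeff b H‖ * r ^ l ≤ r ^ b.degree) :
    ‖coeff m (G * H)‖ * r ^ (k + l) ≤ r ^ m.degree := by
  classical
  rw [coeff_mul, ← le_div_iff₀ (by positivity)]
  refine IsUltrametricDist.norm_sum_le_of_forall_le_of_nonneg (by positivity) fun x hx => ?_
  rw [Finset.HasAntidiagonal.mem_antidiagonal] at hx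
  obtain ⟨ha, hb⟩ := h _ _ hx
  rw [le_div_iff₀ (by positivity)]
  calc ‖coeff x.1 G * coeff x.2 H‖ * r ^ (k + l)
      ≤ (‖coeff x.1 G‖ * ‖coeff x.2 H‖) * r ^ (k + l) := by gcongr; exact norm_mul_le _ _
    _ = (‖coeff x.1 G‖ * r ^ k) * (‖coeff x.2 H‖ * r ^ l) := by ring
    _ ≤ r ^ x.1.degree * r ^ x.2.degree := by gcongr
    _ = r ^ m.degree := by rw [← pow_add, ← hx, map_add]

theorem HasWeight.mul [IsUltrametricDist R] (h0 : 0 < r) (h : HasWeight r k G)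
    (h' : HasWeight r l H) : HasWeight r (k + l) (G * H) := fun m =>
  norm_coeff_mul_le h0 m k l fun a b _ => ⟨h a, h' b⟩

theorem hasWeight_X [NormOneClass R] (h0 : 0 < r) (s : σ) :
    HasWeight r 1 (X s : MvPowerSeries σ R) := fun m => by
  classical
  rw [coeff_X]
  split_ifs with h
  · simp [h]
  · simp only [norm_zero, zero_mul]; positivity

theorem hasWeight_one [NormOneClass R] (h0 : 0 < r) :
    HasWeight r 0 (1 : MvPowerSeries σ R) := fun m => by
  classical
  rw [coeff_one]
  split_ifs with h
  · simp [h]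
  · simp only [norm_zero, zero_mul]; positivity

theorem HasWeight.pow [NormOneClass R] [IsUltrametricDist R] (h0 : 0 < r) (h : HasWeight r k G)
    (n : ℕ) : HasWeight r (n * k) (G ^ n) := by
  induction n with
  | zero => simpa using hasWeight_one h0
  | succ n ih => rw [pow_succ, add_mul, one_mul]; exact ih.mul h0 h

/-- A constant of norm at most r ^ l lowers the weight index by l. With a = aₗ this expresses the
homogeneity of the Weierstrass equation. -/
theorem HasWeight.C_mul {a : R} (h0 : 0 < r) (ha : ‖a‖ ≤ r ^ l) (h : HasWeight r (k + l) G) :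
    HasWeight r k (C a * G) := fun m => by
  rw [coeff_C_mul]
  calc ‖a * coeff m G‖ * r ^ k ≤ (‖a‖ * ‖coeff m G‖) * r ^ k := by gcongr; exact norm_mul_le _ _
    _ ≤ (r ^ l * ‖coeff m G‖) * r ^ k := by gcongr
    _ = ‖coeff m G‖ * r ^ (k + l) := by ring
    _ ≤ _ := h m

/-- Strong induction on the degree: the recursion for the inverse expresses each coefficient through
coefficients of strictly lower degree. -/
theorem HasWeight.invOfUnit [NormOneClass R] [IsUltrametricDist R] (h0 : 0 < r)
    (h : HasWeight r 0 G) : HasWeight r 0 (invOfUnit G 1) := by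
  classical
  intro m
  induction hn : m.degree using Nat.strong_induction_on generalizing m with
  | _ n ih =>
  rw [coeff_invOfUnit]
  split_ifs with hm
  · subst hm; simp at hn; subst hn; simp
  · simp only [inv_one, Units.val_one, neg_mul, one_mul, norm_neg, pow_zero, mul_one]
    refine IsUltrametricDist.norm_sum_le_of_forall_le_of_nonneg (by positivity) fun x hx => ?_
    rw [Finset.HasAntidiagonal.mem_antidiagonal] at hx
    split_ifs with hlt
    · have hd : x.2.degree < n := by
        rw [← hn, ← hx, map_add]
        have : x.1 ≠ 0 := by
          rintro h; rw [h, zero_add] at hx; exact hlt.ne hx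
        have : x.1.degree ≠ 0 := by rwa [Ne, Finsupp.degree_eq_zero_iff]
        omega
      have h2 := ih _ hd x.2 rfl
      have h1 := h x.1
      simp only [pow_zero, mul_one] at h1 h2
      calc _ ≤ ‖coeff x.1 G‖ * ‖coeff x.2 (MvPowerSeries.invOfUnit G 1)‖ := norm_mul_le _ _
        _ ≤ r ^ x.1.degree * r ^ x.2.degree := by gcongr
        _ = _ := by rw [← pow_add, ← hn, ← hx, map_add]
    · simp; positivity

end MvPowerSeries

/-! ### The series w(z) as an X-adic fixed point, and the slope of the chord -/

namespace WeierstrassCurve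

section Formal

variable {R : Type*} [CommRing R] (W : WeierstrassCurve R)

/-- The difference factors as v - w times a cofactor divisible by X, so the step is an X-adic
contraction on series without constant term. -/
theorem X_pow_dvd_formalStep_sub {n : ℕ} {v w : PowerSeries R} (hv : PowerSeries.X ∣ v)
    (hw : PowerSeries.X ∣ w) (h : PowerSeries.X ^ n ∣ v - w) :
    PowerSeries.X ^ (n + 1) ∣ W.formalStep v - W.formalStep w := by
  obtain ⟨a, ha⟩ := hv
  obtain ⟨b, hb⟩ := hw
  obtain ⟨c, hc⟩ := h
  have key : W.formalStep v - W.formalStep w = (v - w) * (PowerSeries.C W.a₁ * PowerSeries.X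
      + PowerSeries.C W.a₂ * PowerSeries.X ^ 2 + PowerSeries.C W.a₃ * (v + w)
      + PowerSeries.C W.a₄ * PowerSeries.X * (v + w)
      + PowerSeries.C W.a₆ * (v * v + v * w + w * w)) := by
    simp only [formalStep]; ring
  rw [key, hc, pow_succ]
  refine mul_dvd_mul (dvd_mul_right _ _) ⟨PowerSeries.C W.a₁
      + PowerSeries.C W.a₂ * PowerSeries.X + PowerSeries.C W.a₃ * (a + b)
      + PowerSeries.C W.a₄ * (v + w)
      + PowerSeries.C W.a₆ * (a * v + a * w + b * w), ?_⟩
  rw [ha, hb]; ring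

theorem X_dvd_formalStep {v : PowerSeries R} (hv : PowerSeries.X ∣ v) :
    PowerSeries.X ∣ W.formalStep v := by
  obtain ⟨a, rfl⟩ := hv
  refine ⟨PowerSeries.X ^ 2 + PowerSeries.C W.a₁ * PowerSeries.X * a
    + PowerSeries.C W.a₂ * PowerSeries.X ^ 2 * a + PowerSeries.C W.a₃ * PowerSeries.X * a ^ 2
    + PowerSeries.C W.a₄ * PowerSeries.X ^ 2 * a ^ 2
    + PowerSeries.C W.a₆ * PowerSeries.X ^ 2 * a ^ 3, ?_⟩
  simp only [formalStep]; ring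

theorem X_dvd_formalStep_iterate (n : ℕ) : PowerSeries.X ∣ W.formalStep^[n] 0 := by
  induction n with
  | zero => simp
  | succ n ih => rw [Function.iterate_succ_apply']; exact W.X_dvd_formalStep ih

theorem X_pow_dvd_iterate_succ_sub (n : ℕ) :
    PowerSeries.X ^ (n + 1) ∣ W.formalStep^[n + 1] 0 - W.formalStep^[n] 0 := by
  induction n with
  | zero => simpa using W.X_dvd_formalStep_iterate 1
  | succ n ih =>
    have h := W.X_pow_dvd_formalStep_sub (W.X_dvd_formalStep_iterate (n + 1))
      (W.X_dvd_formalStep_iterate n) ih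
    rwa [← Function.iterate_succ_apply' W.formalStep,
      ← Function.iterate_succ_apply' W.formalStep] at h

theorem X_pow_dvd_iterate_add_sub (n k : ℕ) :
    PowerSeries.X ^ (n + 1) ∣ W.formalStep^[n + k] 0 - W.formalStep^[n] 0 := by
  induction k with
  | zero => simp
  | succ k ih =>
    have := dvd_add ((pow_dvd_pow _ (by omega)).trans (W.X_pow_dvd_iterate_succ_sub (n + k))) ih
    rw [← add_assoc]
    simpa using this

theorem coeff_formalW {i n : ℕ} (h : i ≤ n) :
    PowerSeries.coeff i W.formalW = PowerSeries.coeff i (W.formalStep^[n] 0) := by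
  obtain ⟨k, rfl⟩ := Nat.exists_eq_add_of_le h
  have := PowerSeries.X_pow_dvd_iff.1 (W.X_pow_dvd_iterate_add_sub i k) i (by omega)
  rw [map_sub, sub_eq_zero] at this
  rw [formalW, PowerSeries.coeff_mk, this]

theorem X_pow_dvd_formalW_sub (n : ℕ) :
    PowerSeries.X ^ (n + 1) ∣ W.formalW - W.formalStep^[n] 0 := by
  rw [PowerSeries.X_pow_dvd_iff]
  intro m hm
  rw [map_sub, W.coeff_formalW (by omega : m ≤ n), sub_self]

theorem X_dvd_formalW : PowerSeries.X ∣ W.formalW := by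
  simpa using W.X_pow_dvd_formalW_sub 0

theorem formalStep_formalW : W.formalStep W.formalW = W.formalW := by
  ext n
  have := PowerSeries.X_pow_dvd_iff.1 (W.X_pow_dvd_formalStep_sub W.X_dvd_formalW
    (W.X_dvd_formalStep_iterate n) (W.X_pow_dvd_formalW_sub n)) n (by omega)
  rw [map_sub, sub_eq_zero, ← Function.iterate_succ_apply' W.formalStep] at this
  rw [this, ← W.coeff_formalW (by omega)]

/-- The power series `w(z₁)` and `w(z₂)` in two variables. -/
def formalWAt (i : Fin 2) : MvPowerSeries (Fin 2) R :=
  W.formalW.subst (X i : MvPowerSeries (Fin 2) R)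

theorem formalWAt_eq (i : Fin 2) : W.formalWAt i = X i ^ 3 + C W.a₁ * X i * W.formalWAt i
    + C W.a₂ * X i ^ 2 * W.formalWAt i + C W.a₃ * W.formalWAt i ^ 2
    + C W.a₄ * X i * W.formalWAt i ^ 2 + C W.a₆ * W.formalWAt i ^ 3 := by
  have h := congrArg (PowerSeries.substAlgHom (PowerSeries.HasSubst.X (S := R) i))
    W.formalStep_formalW
  have hC (a : R) : PowerSeries.subst (X i : MvPowerSeries (Fin 2) R) (PowerSeries.C a) = C a :=
    PowerSeries.subst_C _
  simp only [formalStep, map_add, map_mul, map_pow, PowerSeries.coe_substAlgHom, hC,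
    PowerSeries.subst_X (PowerSeries.HasSubst.X (S := R) i)] at h
  exact h.symm

theorem coeff_formalWAt (i : Fin 2) (m : Fin 2 →₀ ℕ) : coeff m (W.formalWAt i) =
    if m = Finsupp.single i (m i) then PowerSeries.coeff (m i) W.formalW else 0 :=
  PowerSeries.coeff_subst_single _ _ _

theorem constantCoeff_formalW : PowerSeries.coeff 0 W.formalW = 0 := by
  have := PowerSeries.X_dvd_iff.1 W.X_dvd_formalW
  simpa using this

/-- Coefficients of the slope depend only on i + j, so multiplying by z₁ - z₂ telescopes and only
pure powers of z₁ or z₂ survive. -/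
theorem formalSlope_mul_X_sub_X :
    W.formalSlope * (X 0 - X 1) = W.formalWAt 0 - W.formalWAt 1 := by
  ext m
  have hX (i : Fin 2) : coeff m (W.formalSlope * X i) =
      if m i = 0 then 0 else PowerSeries.coeff (m 0 + m 1) W.formalW := by
    rw [X, coeff_mul_monomial]
    simp only [Finsupp.single_le_iff]
    by_cases h : m i = 0
    · rw [if_neg (by omega), if_pos h]
    · rw [if_pos (by omega), if_neg h, mul_one]
      change PowerSeries.coeff _ W.formalW = _
      congr 1
      obtain rfl | rfl : i = 0 ∨ i = 1 := by omega
      · simp; congr 1; omega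
      · simp; congr 1; omega
  have h0 : m = Finsupp.single 0 (m 0) ↔ m 1 = 0 := by
    rw [Finsupp.ext_iff, Fin.forall_fin_two]; simp
  have h1 : m = Finsupp.single 1 (m 1) ↔ m 0 = 0 := by
    rw [Finsupp.ext_iff, Fin.forall_fin_two]; simp
  rw [mul_sub, map_sub, map_sub, hX, hX, coeff_formalWAt, coeff_formalWAt]
  simp only [h0, h1]
  by_cases a : m 0 = 0 <;> by_cases b : m 1 = 0 <;> simp [a, b, constantCoeff_formalW]

end Formal

end WeierstrassCurve

end

noncomputable section

open MvPowerSeries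

namespace WeierstrassCurve

/-! ### Vieta's relations for the third intersection point -/

section FormalIdentities

variable {R : Type*} [CommRing R] (W : WeierstrassCurve R)

theorem formalIntercept_eq : W.formalIntercept = W.formalWAt 0 - W.formalSlope * X 0 := rfl

theorem formalWAt_zero_eq : W.formalWAt 0 = W.formalSlope * X 0 + W.formalIntercept := by
  rw [formalIntercept_eq]; ring

theorem formalWAt_one_eq : W.formalWAt 1 = W.formalSlope * X 1 + W.formalIntercept := by
  rw [formalIntercept_eq]
  linear_combination W.formalSlope_mul_X_sub_X

/-- The coefficient of `z³` in `f(z, λ z + ν)`. -/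
def formalLead : MvPowerSeries (Fin 2) R :=
  1 + C W.a₂ * W.formalSlope + C W.a₄ * W.formalSlope ^ 2 + C W.a₆ * W.formalSlope ^ 3

theorem constantCoeff_formalSlope_eq :
    constantCoeff W.formalSlope = PowerSeries.coeff 1 W.formalW := rfl

theorem coeff_one_formalW : PowerSeries.coeff 1 W.formalW = 0 := by
  rw [W.coeff_formalW (le_refl 1)]
  simp [formalStep, PowerSeries.coeff_X_pow]

theorem constantCoeff_formalLead : constantCoeff W.formalLead = 1 := by
  simp [formalLead, constantCoeff_formalSlope_eq, coeff_one_formalW]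

theorem formalThird_eq : W.formalThird = -X 0 - X 1 -
    (C W.a₁ * W.formalSlope + C W.a₂ * W.formalIntercept + C W.a₃ * W.formalSlope ^ 2
      + 2 * C W.a₄ * W.formalSlope * W.formalIntercept
      + 3 * C W.a₆ * W.formalSlope ^ 2 * W.formalIntercept) * invOfUnit W.formalLead 1 := rfl

theorem formalLead_mul_inv : W.formalLead * invOfUnit W.formalLead 1 = 1 :=
  mul_invOfUnit _ _ (by simp [constantCoeff_formalLead])

theorem formalLead_mul_sum : W.formalLead * (X 0 + X 1 + W.formalThird) =
    -(C W.a₁ * W.formalSlope + C W.a₂ * W.formalIntercept + C W.a₃ * W.formalSlope ^ 2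
      + 2 * C W.a₄ * W.formalSlope * W.formalIntercept
      + 3 * C W.a₆ * W.formalSlope ^ 2 * W.formalIntercept) := by
  rw [formalThird_eq]
  linear_combination -(C W.a₁ * W.formalSlope + C W.a₂ * W.formalIntercept
    + C W.a₃ * W.formalSlope ^ 2 + 2 * C W.a₄ * W.formalSlope * W.formalIntercept
    + 3 * C W.a₆ * W.formalSlope ^ 2 * W.formalIntercept) * W.formalLead_mul_inv

/-- The cubic f(z, λz + ν) - (λz + ν) vanishes at z₁ and z₂. Subtracting the two equations and using
the known root sum leaves this relation times z₁ - z₂, which cancels in a domain. -/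
theorem formalLead_mul_sum_mul [IsDomain R] :
    W.formalLead * (X 0 * X 1 + X 0 * W.formalThird + X 1 * W.formalThird) =
    C W.a₁ * W.formalIntercept + 2 * C W.a₃ * W.formalSlope * W.formalIntercept
      + C W.a₄ * W.formalIntercept ^ 2 + 3 * C W.a₆ * W.formalSlope * W.formalIntercept ^ 2
      - W.formalSlope := by
  have hne : (X 0 - X 1 : MvPowerSeries (Fin 2) R) ≠ 0 := by
    intro h
    have := congrArg (coeff (Finsupp.single 0 1)) h
    rw [map_sub, coeff_index_single_X, coeff_index_single_X] at this
    simp at this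
  apply mul_left_cancel₀ hne
  have e0 := W.formalWAt_eq 0
  have e1 := W.formalWAt_eq 1
  rw [formalWAt_zero_eq] at e0
  rw [formalWAt_one_eq] at e1
  have hs := W.formalLead_mul_sum
  rw [formalLead] at hs ⊢
  linear_combination e0 - e1 + (X 0 ^ 2 - X 1 ^ 2) * hs

theorem formalLead_mul_prod [IsDomain R] :
    W.formalLead * (X 0 * X 1 * W.formalThird) =
    W.formalIntercept - C W.a₃ * W.formalIntercept ^ 2 - C W.a₆ * W.formalIntercept ^ 3 := by
  have e0 := W.formalWAt_eq 0
  rw [formalWAt_zero_eq] at e0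
  have hs := W.formalLead_mul_sum
  have ht := W.formalLead_mul_sum_mul
  rw [formalLead] at hs ht ⊢
  linear_combination - e0 - X 0 ^ 2 * hs + X 0 * ht

/-- The power series `1 - a₁ z₃ - a₃ w₃`. -/
def formalNegDenom : MvPowerSeries (Fin 2) R :=
  1 - C W.a₁ * W.formalThird - C W.a₃ * (W.formalSlope * W.formalThird + W.formalIntercept)

theorem formalGroupLaw_eq :
    W.formalGroupLaw = -W.formalThird * invOfUnit W.formalNegDenom 1 := rfl

theorem constantCoeff_formalIntercept : constantCoeff W.formalIntercept = 0 := by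
  have h : constantCoeff (W.formalWAt 0) = 0 := by
    rw [← coeff_zero_eq_constantCoeff_apply, coeff_formalWAt]
    simpa using W.constantCoeff_formalW
  simp [formalIntercept_eq, h]

theorem constantCoeff_formalThird : constantCoeff W.formalThird = 0 := by
  simp [formalThird_eq, constantCoeff_formalIntercept, constantCoeff_formalSlope_eq,
    coeff_one_formalW]

theorem constantCoeff_formalNegDenom : constantCoeff W.formalNegDenom = 1 := by
  simp [formalNegDenom, constantCoeff_formalIntercept, constantCoeff_formalThird]

theorem formalGroupLaw_mul_formalNegDenom :
    W.formalGroupLaw * W.formalNegDenom = -W.formalThird := by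
  have := mul_invOfUnit W.formalNegDenom 1 (by simp [constantCoeff_formalNegDenom])
  rw [formalGroupLaw_eq]
  linear_combination -W.formalThird * this

end FormalIdentities

/-! ### Weights of the series attached to the chord -/

section FormalWeights

variable {R : Type*} [NormedCommRing R] [NormOneClass R] [IsUltrametricDist R]

/-- The coefficient `aᵢ` has norm at most `r ^ i`. -/
structure CoeffBound (W : WeierstrassCurve R) (r : ℝ) : Prop where
  pos : 0 < r
  lt_one : r < 1
  norm_le_one : ∀ x : R, ‖x‖ ≤ 1
  a₁ : ‖W.a₁‖ ≤ r ^ 1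
  a₂ : ‖W.a₂‖ ≤ r ^ 2
  a₃ : ‖W.a₃‖ ≤ r ^ 3
  a₄ : ‖W.a₄‖ ≤ r ^ 4
  a₆ : ‖W.a₆‖ ≤ r ^ 6

variable {W : WeierstrassCurve R} {r : ℝ} (B : W.CoeffBound r)
include B

omit [NormOneClass R] [IsUltrametricDist R] in
theorem CoeffBound.norm_mul_le {a : R} {l : ℕ} (h : ‖a‖ ≤ r ^ l) (b : R) : ‖b * a‖ ≤ r ^ l :=
  calc ‖b * a‖ ≤ ‖b‖ * ‖a‖ := _root_.norm_mul_le _ _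
    _ ≤ 1 * r ^ l := mul_le_mul (B.norm_le_one b) h (norm_nonneg _) zero_le_one
    _ = r ^ l := one_mul _

theorem CoeffBound.formalStep {w : PowerSeries R} (h : HasWeight (σ := Unit) r 3 w) :
    HasWeight (σ := Unit) r 3 (W.formalStep w) := by
  have h0 := B.pos
  have hX : HasWeight r 1 (X () : MvPowerSeries Unit R) := hasWeight_X h0 ()
  refine (((((?_ : HasWeight _ _ _).add h0 ?_).add h0 ?_).add h0 ?_).add h0 ?_).add h0 ?_
  · exact hX.pow h0 3
  · have : HasWeight (σ := Unit) r 3 (C W.a₁ * (X () * w)) := ((hX.mul h0 h)).C_mul h0 B.a₁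
    rw [← mul_assoc] at this; exact this
  · have : HasWeight (σ := Unit) r 3 (C W.a₂ * (X () ^ 2 * w)) :=
      ((hX.pow h0 2).mul h0 h).C_mul h0 B.a₂
    rw [← mul_assoc] at this; exact this
  · exact HasWeight.C_mul (σ := Unit) h0 B.a₃ (h.pow h0 2)
  · have : HasWeight (σ := Unit) r 3 (C W.a₄ * (X () * w ^ 2)) :=
      (hX.mul h0 (h.pow h0 2)).C_mul h0 B.a₄
    rw [← mul_assoc] at this; exact this
  · exact HasWeight.C_mul (σ := Unit) h0 B.a₆ (h.pow h0 3)

/-- Every monomial of f(z, w) has weight index 3 if w has, so the bound passes through all iterates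
of the step and to the limit. -/
theorem CoeffBound.norm_coeff_formalW (n : ℕ) :
    ‖PowerSeries.coeff n W.formalW‖ * r ^ 3 ≤ r ^ n := by
  have h (k : ℕ) : HasWeight (σ := Unit) r 3 (W.formalStep^[k] 0) := by
    induction k with
    | zero => exact hasWeight_zero B.pos
    | succ k ih => rw [Function.iterate_succ_apply']; exact B.formalStep ih
  rw [W.coeff_formalW le_rfl]
  have := h n (Finsupp.single () n)
  simpa using this

omit B in
theorem degree_fin_two (m : Fin 2 →₀ ℕ) : m.degree = m 0 + m 1 := by
  rw [Finsupp.degree_eq_sum]; simp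

theorem CoeffBound.formalWAt (i : Fin 2) : HasWeight r 3 (W.formalWAt i) := fun m => by
  rw [coeff_formalWAt]
  split_ifs with h
  · have h2 : m.degree = m i := by conv_lhs => rw [h, Finsupp.degree_single]
    rw [h2]
    exact B.norm_coeff_formalW _
  · have := B.pos
    simp; positivity

theorem CoeffBound.formalSlope : HasWeight r 2 W.formalSlope := fun m => by
  have h := B.norm_coeff_formalW (m 0 + m 1 + 1)
  rw [degree_fin_two]
  change ‖PowerSeries.coeff (m 0 + m 1 + 1) W.formalW‖ * r ^ 2 ≤ _
  have h0 := B.pos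
  refine le_of_mul_le_mul_right ?_ h0
  calc _ = _ := by ring
    _ ≤ _ := h
    _ = _ := by ring

theorem CoeffBound.formalIntercept : HasWeight r 3 W.formalIntercept := by
  rw [formalIntercept_eq]
  exact (B.formalWAt 0).sub B.pos (B.formalSlope.mul B.pos (hasWeight_X B.pos 0))

theorem CoeffBound.formalLead : HasWeight r 0 W.formalLead := by
  have h0 := B.pos
  have hs := B.formalSlope
  exact (((hasWeight_one h0).add h0 (hs.C_mul (k := 0) h0 B.a₂)).add h0
    ((hs.pow h0 2).C_mul (k := 0) h0 B.a₄)).add h0 ((hs.pow h0 3).C_mul (k := 0) h0 B.a₆)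

/-- Slope and intercept have indices 2 and 3, so every term of the numerator drops to index 1 after
multiplication by its aᵢ. The integers 2 and 3 are harmless because they have norm at most 1. -/
theorem CoeffBound.formalThird : HasWeight r 1 W.formalThird := by
  have h0 := B.pos
  have hs := B.formalSlope
  have ht := B.formalIntercept
  have hX (i : Fin 2) : HasWeight r 1 (X i : MvPowerSeries (Fin 2) R) := hasWeight_X h0 i
  have h2 : (2 : MvPowerSeries (Fin 2) R) = C 2 := (map_ofNat C 2).symm
  have h3 : (3 : MvPowerSeries (Fin 2) R) = C 3 := (map_ofNat C 3).symm
  rw [formalThird_eq, h2, h3, ← map_mul, ← map_mul, mul_assoc (C _), mul_assoc (C _)]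
  refine ((hX 0).neg.sub h0 (hX 1)).sub h0 (HasWeight.mul (k := 1) (l := 0) h0 ?_
    (B.formalLead.invOfUnit h0))
  exact ((((hs.C_mul (k := 1) h0 B.a₁).add h0 (ht.C_mul (k := 1) h0 B.a₂)).add h0
    ((hs.pow h0 2).C_mul (k := 1) h0 B.a₃)).add h0
    ((hs.mul h0 ht).C_mul (k := 1) h0 (B.norm_mul_le B.a₄ 2))).add h0
    (((hs.pow h0 2).mul h0 ht).C_mul (k := 1) h0 (B.norm_mul_le B.a₆ 3))

theorem CoeffBound.formalNegDenom : HasWeight r 0 W.formalNegDenom := by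
  have h0 := B.pos
  exact ((hasWeight_one h0).sub h0 (B.formalThird.C_mul (k := 0) h0 B.a₁)).sub h0
    (((B.formalSlope.mul h0 B.formalThird).add h0 B.formalIntercept).C_mul (k := 0) h0 B.a₃)

/-- The decisive estimate ‖cᵢⱼ‖ ≤ r ^ (i + j - 1): the coefficients themselves are summable, so F
converges on the whole unit ball. -/
theorem CoeffBound.formalGroupLaw : HasWeight r 1 W.formalGroupLaw := by
  rw [formalGroupLaw_eq]
  exact B.formalThird.neg.mul B.pos
    (B.formalNegDenom.invOfUnit B.pos)

end FormalWeights

end WeierstrassCurve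

end

noncomputable section

open MvPowerSeries Filter Topology

/-! ### Evaluation of weighted series on the unit ball -/

namespace MvPowerSeries

variable {R : Type*} [NormedCommRing R]

/-- The term of degree `m` of the value of a power series in two variables. -/
def summandAt (u v : R) (G : MvPowerSeries (Fin 2) R) (m : Fin 2 →₀ ℕ) : R :=
  coeff m G * u ^ m 0 * v ^ m 1

/-- The value of a power series in two variables. -/
def evalAt (u v : R) (G : MvPowerSeries (Fin 2) R) : R := ∑' m, summandAt u v G m

variable {r : ℝ} {k l : ℕ} {G H : MvPowerSeries (Fin 2) R}

theorem summable_pow_degree (h0 : 0 < r) (h1 : r < 1) :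
    Summable fun m : Fin 2 →₀ ℕ => r ^ m.degree := by
  have hg := summable_geometric_of_lt_one h0.le h1
  have h2 := hg.mul_of_nonneg hg (fun _ => by positivity) (fun _ => by positivity)
  let e : (Fin 2 →₀ ℕ) ≃ ℕ × ℕ := Finsupp.equivFunOnFinite.trans (finTwoArrowEquiv ℕ)
  refine (e.summable_iff.2 h2).congr fun m => ?_
  rw [WeierstrassCurve.degree_fin_two, pow_add]
  rfl

section Basic

theorem norm_mul_le_left (hn : ∀ x : R, ‖x‖ ≤ 1) (a b : R) : ‖a * b‖ ≤ ‖a‖ :=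
  (norm_mul_le _ _).trans (mul_le_of_le_one_right (norm_nonneg _) (hn b))

theorem norm_mul_le_right (hn : ∀ x : R, ‖x‖ ≤ 1) (a b : R) : ‖a * b‖ ≤ ‖b‖ := by
  rw [mul_comm]; exact norm_mul_le_left hn b a

theorem norm_summandAt_le_coeff (hn : ∀ x : R, ‖x‖ ≤ 1) (u v : R) (m : Fin 2 →₀ ℕ) :
    ‖summandAt u v G m‖ ≤ ‖coeff m G‖ :=
  (norm_mul_le_left hn _ _).trans (norm_mul_le_left hn _ _)

theorem HasWeight.norm_coeff_le (h0 : 0 < r) (hG : HasWeight r k G) (m : Fin 2 →₀ ℕ) :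
    ‖coeff m G‖ ≤ (r ^ k)⁻¹ * r ^ m.degree := by
  rw [inv_mul_eq_div, le_div_iff₀ (by positivity)]; exact hG m

theorem HasWeight.summable_norm_coeff (h0 : 0 < r) (h1 : r < 1) (hG : HasWeight r k G) :
    Summable fun m => ‖coeff m G‖ :=
  Summable.of_nonneg_of_le (fun _ => norm_nonneg _) (hG.norm_coeff_le h0)
    ((summable_pow_degree h0 h1).mul_left _)

theorem HasWeight.summable_norm (h0 : 0 < r) (h1 : r < 1) (hn : ∀ x : R, ‖x‖ ≤ 1)
    (hG : HasWeight r k G) (u v : R) : Summable fun m => ‖summandAt u v G m‖ :=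
  Summable.of_nonneg_of_le (fun _ => norm_nonneg _)
    (norm_summandAt_le_coeff hn u v) (hG.summable_norm_coeff h0 h1)

variable [CompleteSpace R]

theorem HasWeight.summable (h0 : 0 < r) (h1 : r < 1) (hn : ∀ x : R, ‖x‖ ≤ 1)
    (hG : HasWeight r k G) (u v : R) : Summable (summandAt u v G) :=
  (hG.summable_norm h0 h1 hn u v).of_norm

theorem HasWeight.evalAt_add (h0 : 0 < r) (h1 : r < 1) (hn : ∀ x : R, ‖x‖ ≤ 1)
    (hG : HasWeight r k G) (hH : HasWeight r l H) (u v : R) :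
    evalAt u v (G + H) = evalAt u v G + evalAt u v H := by
  rw [evalAt, evalAt, evalAt,
    ← (hG.summable h0 h1 hn u v).tsum_add (hH.summable h0 h1 hn u v)]
  congr 1; ext m
  simp only [summandAt, map_add]; ring

theorem HasWeight.evalAt_mul (h0 : 0 < r) (h1 : r < 1) (hn : ∀ x : R, ‖x‖ ≤ 1)
    (hG : HasWeight r k G) (hH : HasWeight r l H) (u v : R) :
    evalAt u v (G * H) = evalAt u v G * evalAt u v H := by
  have hs := hG.summable_norm h0 h1 hn u v
  have ht := hH.summable_norm h0 h1 hn u v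
  have hp := summable_mul_of_summable_norm hs ht
  rw [evalAt, evalAt, evalAt,
    hs.of_norm.tsum_mul_tsum_eq_tsum_sum_antidiagonal ht.of_norm hp]
  congr 1; ext m
  classical
  rw [summandAt, coeff_mul, Finset.sum_mul, Finset.sum_mul]
  refine Finset.sum_congr rfl fun x hx => ?_
  rw [Finset.HasAntidiagonal.mem_antidiagonal] at hx
  rw [← hx]
  simp only [summandAt, Finsupp.add_apply, pow_add]; ring

omit [CompleteSpace R] in
theorem evalAt_X_zero (u v : R) : evalAt u v (X 0) = u := by
  classical
  rw [evalAt, tsum_eq_single (Finsupp.single 0 1)]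
  · simp [summandAt]
  · intro m hm; simp [summandAt, coeff_X, hm]

omit [CompleteSpace R] in
theorem evalAt_X_one (u v : R) : evalAt u v (X 1) = v := by
  classical
  rw [evalAt, tsum_eq_single (Finsupp.single 1 1)]
  · simp [summandAt]
  · intro m hm; simp [summandAt, coeff_X, hm]

omit [CompleteSpace R] in
theorem evalAt_C (u v a : R) : evalAt u v (C a) = a := by
  classical
  rw [evalAt, tsum_eq_single 0]
  · simp [summandAt]
  · intro m hm; simp [summandAt, coeff_C, hm]

theorem HasWeight.continuous_evalAt (h0 : 0 < r) (h1 : r < 1) (hn : ∀ x : R, ‖x‖ ≤ 1)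
    (hG : HasWeight r k G) : Continuous fun p : R × R => evalAt p.1 p.2 G :=
  continuous_tsum (fun m => by unfold summandAt; fun_prop) (hG.summable_norm_coeff h0 h1)
    fun m p => norm_summandAt_le_coeff hn p.1 p.2 m

variable [IsUltrametricDist R]

/-- The mixed difference kills all monomials in u alone or v alone; those that remain are divisible
by uv. -/
theorem HasWeight.norm_evalAt_mixed_le (h0 : 0 < r) (h1 : r < 1) (hn : ∀ x : R, ‖x‖ ≤ 1)
    (hG : HasWeight r k G) (u v : R) :
    ‖evalAt u v G - evalAt u 0 G - evalAt 0 v G + evalAt 0 0 G‖ ≤ ‖u‖ * ‖v‖ := by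
  have S (a b : R) := hG.summable h0 h1 hn a b
  rw [evalAt, evalAt, evalAt, evalAt, ← (S u v).tsum_sub (S u 0),
    ← ((S u v).sub (S u 0)).tsum_sub (S 0 v),
    ← (((S u v).sub (S u 0)).sub (S 0 v)).tsum_add (S 0 0)]
  refine IsUltrametricDist.norm_tsum_le_of_forall_le_of_nonneg (by positivity) fun m => ?_
  have e : summandAt u v G m - summandAt u 0 G m - summandAt 0 v G m + summandAt 0 0 G m
      = coeff m G * ((u ^ m 0 - 0 ^ m 0) * (v ^ m 1 - 0 ^ m 1)) := by
    simp only [summandAt]; ring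
  have hp (w : R) (n : ℕ) : ‖w ^ n - 0 ^ n‖ ≤ ‖w‖ := by
    cases n with
    | zero => simp
    | succ n =>
      rw [zero_pow n.succ_ne_zero, sub_zero, pow_succ]; exact norm_mul_le_right hn _ _
  rw [e]
  refine (norm_mul_le_right hn _ _).trans ((norm_mul_le _ _).trans ?_)
  gcongr <;> exact hp _ _

/-- For fixed t, the series G(u, t) - G(u, 0) in u has all coefficients divisible by t. Truncating
it to a polynomial allows composition later without substituting convergent series. -/
theorem HasWeight.exists_polynomial (h0 : 0 < r) (h1 : r < 1) (hn : ∀ x : R, ‖x‖ ≤ 1)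
    (hG : HasWeight r 1 G) (t : R) {ε : ℝ} (hε : 0 < ε) :
    ∃ P : Polynomial R, (∀ n, ‖P.coeff n‖ ≤ ‖t‖ * r ^ n) ∧
      ∀ u, ‖evalAt u t G - evalAt u 0 G - P.eval u‖ ≤ ε := by
  classical
  -- Keep the finitely many monomials whose coefficient has norm at least ε; the ultrametric tail is
  -- then at most ε.
  have hfin := (hG.summable_norm_coeff h0 h1).tendsto_cofinite_zero.eventually (gt_mem_nhds hε)
  rw [eventually_cofinite] at hfin
  set s := hfin.toFinset with hs
  refine ⟨∑ m ∈ s, Polynomial.monomial (m 0) (coeff m G * (t ^ m 1 - 0 ^ m 1)), fun n => ?_,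
    fun u => ?_⟩
  · rw [Polynomial.finsetSum_coeff]
    refine IsUltrametricDist.norm_sum_le_of_forall_le_of_nonneg (by positivity) fun m _ => ?_
    rw [Polynomial.coeff_monomial]
    split_ifs with hm
    · rcases Nat.eq_zero_or_pos (m 1) with h | h
      · simp only [h, pow_zero, sub_self, mul_zero, norm_zero]; positivity
      -- The exponent of t is at least 1, which compensates for the weight index 1.
      · have hc : ‖coeff m G‖ ≤ r ^ n := by
          have := hG m
          rw [WeierstrassCurve.degree_fin_two, hm] at this
          refine le_of_mul_le_mul_right (this.trans ?_) (pow_pos h0 1)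
          rw [← pow_add]
          exact pow_le_pow_of_le_one h0.le h1.le (by omega)
        obtain ⟨j, hj⟩ := Nat.exists_eq_add_of_le' h
        rw [hj, zero_pow (by omega), sub_zero, pow_succ]
        calc _ ≤ ‖coeff m G‖ * ‖t ^ j * t‖ := norm_mul_le _ _
          _ ≤ r ^ n * ‖t‖ := by gcongr; exact norm_mul_le_right hn _ _
          _ = _ := mul_comm _ _
    · simp only [norm_zero]; positivity
  · have S (a b : R) := hG.summable h0 h1 hn a b
    have e : Polynomial.eval u (∑ m ∈ s, Polynomial.monomial (m 0)
        (coeff m G * (t ^ m 1 - 0 ^ m 1))) =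
        ∑' m, (if m ∈ s then coeff m G * (t ^ m 1 - 0 ^ m 1) * u ^ m 0 else 0) := by
      rw [tsum_eq_sum (s := s) (fun m hm => if_neg hm), Polynomial.eval_finsetSum]
      exact Finset.sum_congr rfl fun m hm => by rw [if_pos hm, Polynomial.eval_monomial]
    have hsum : Summable fun m =>
        (if m ∈ s then coeff m G * (t ^ m 1 - 0 ^ m 1) * u ^ m 0 else 0) :=
      summable_of_ne_finset_zero (s := s) fun m hm => if_neg hm
    rw [e, evalAt, evalAt, ← (S u t).tsum_sub (S u 0), ← ((S u t).sub (S u 0)).tsum_sub hsum]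
    refine IsUltrametricDist.norm_tsum_le_of_forall_le_of_nonneg hε.le fun m => ?_
    have e2 : summandAt u t G m - summandAt u 0 G m =
        coeff m G * (t ^ m 1 - 0 ^ m 1) * u ^ m 0 := by simp only [summandAt]; ring
    rw [e2]
    split_ifs with hm
    · simp [hε.le]
    · rw [sub_zero, mul_assoc]
      refine (norm_mul_le_left hn _ _).trans ?_
      have : ‖coeff m G‖ < ε := by simpa [hs] using hm
      exact this.le

end Basic

end MvPowerSeries

end

noncomputable section

/-! ### The chord-tangent law in the coordinates (z, w) -/

namespace WeierstrassCurve

/-- The Weierstrass equation in the coordinates `z = -x/y`, `w = -1/y`. -/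
def ZWEquation {R : Type*} [CommRing R] (W : WeierstrassCurve R) (z w : R) : Prop :=
  w = z ^ 3 + W.a₁ * z * w + W.a₂ * z ^ 2 * w + W.a₃ * w ^ 2 + W.a₄ * z * w ^ 2 + W.a₆ * w ^ 3

/-- The line `w = s z + t` meets the curve in the points with `z`-coordinates `z₁`, `z₂`, `z₃`,
counted with multiplicity; `c` is the leading coefficient of the corresponding cubic. -/
structure LineMeets {R : Type*} [CommRing R] (W : WeierstrassCurve R) (s t c z₁ z₂ z₃ : R) :
    Prop where
  lead : c = 1 + W.a₂ * s + W.a₄ * s ^ 2 + W.a₆ * s ^ 3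
  sum : c * (z₁ + z₂ + z₃) = -(W.a₁ * s + W.a₂ * t + W.a₃ * s ^ 2 + 2 * W.a₄ * s * t
    + 3 * W.a₆ * s ^ 2 * t)
  sum_mul : c * (z₁ * z₂ + z₁ * z₃ + z₂ * z₃) = W.a₁ * t + 2 * W.a₃ * s * t + W.a₄ * t ^ 2
    + 3 * W.a₆ * s * t ^ 2 - s
  prod : c * (z₁ * z₂ * z₃) = t - W.a₃ * t ^ 2 - W.a₆ * t ^ 3

namespace LineMeets

section Ring

variable {R : Type*} [CommRing R] {W : WeierstrassCurve R} {s t c z₁ z₂ z₃ : R}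

theorem rotate (h : W.LineMeets s t c z₁ z₂ z₃) : W.LineMeets s t c z₂ z₃ z₁ :=
  ⟨h.lead, by rw [← h.sum]; ring, by rw [← h.sum_mul]; ring, by rw [← h.prod]; ring⟩

theorem zwEquation (h : W.LineMeets s t c z₁ z₂ z₃) : W.ZWEquation z₁ (s * z₁ + t) := by
  unfold ZWEquation
  linear_combination -z₁ ^ 2 * h.sum + z₁ * h.sum_mul - h.prod + z₁ ^ 3 * h.lead

theorem map {S : Type*} [CommRing S] (f : R →+* S) (h : W.LineMeets s t c z₁ z₂ z₃) :
    (W.map f).LineMeets (f s) (f t) (f c) (f z₁) (f z₂) (f z₃) where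
  lead := by
    have := congrArg f h.lead
    simpa only [map_mul, map_add, map_neg, map_sub, map_pow, map_one, map_ofNat, map_a₁, map_a₂,
      map_a₃, map_a₄, map_a₆] using this
  sum := by
    have := congrArg f h.sum
    simpa only [map_mul, map_add, map_neg, map_sub, map_pow, map_one, map_ofNat, map_a₁, map_a₂,
      map_a₃, map_a₄, map_a₆] using this
  sum_mul := by
    have := congrArg f h.sum_mul
    simpa only [map_mul, map_add, map_neg, map_sub, map_pow, map_one, map_ofNat, map_a₁, map_a₂,
      map_a₃, map_a₄, map_a₆] using this
  prod := by
    have := congrArg f h.prod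
    simpa only [map_mul, map_add, map_neg, map_sub, map_pow, map_one, map_ofNat, map_a₁, map_a₂,
      map_a₃, map_a₄, map_a₆] using this

end Ring

section Field

variable {F : Type*} [Field F] {V : WeierstrassCurve F} {s t c z₁ z₂ z₃ : F}

/-- For s ≠ 0 this evaluates the cubic at z = -t/s, where w = 0 and f(z, 0) = z³; as a polynomial
identity it holds for every s. -/
theorem lead_mul_prod (h : V.LineMeets s t c z₁ z₂ z₃) :
    c * ((s * z₁ + t) * (s * z₂ + t) * (s * z₃ + t)) = t ^ 3 := by
  linear_combination s ^ 3 * h.prod + s ^ 2 * t * h.sum_mul + s * t ^ 2 * h.sum + t ^ 3 * h.lead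

/-- In the affine plane the line w = sz + t is y = (s/t)x - 1/t, and this is the usual formula for
the sum of the x-coordinates on a line of slope s/t. -/
theorem sum_x (h : V.LineMeets s t c z₁ z₂ z₃) (hc : c ≠ 0) (ht : t ≠ 0) (h₁ : s * z₁ + t ≠ 0)
    (h₂ : s * z₂ + t ≠ 0) (h₃ : s * z₃ + t ≠ 0) :
    (s / t) ^ 2 + V.a₁ * (s / t) - V.a₂ =
      z₁ / (s * z₁ + t) + z₂ / (s * z₂ + t) + z₃ / (s * z₃ + t) := by
  have e1 : c * (z₁ * (s * z₂ + t) * (s * z₃ + t) + z₂ * (s * z₁ + t) * (s * z₃ + t)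
      + z₃ * (s * z₁ + t) * (s * z₂ + t)) = t * (s ^ 2 + V.a₁ * s * t - V.a₂ * t ^ 2) := by
    linear_combination 3 * s ^ 2 * h.prod + 2 * s * t * h.sum_mul + t ^ 2 * h.sum
  have e2 := h.lead_mul_prod
  have hsum : z₁ / (s * z₁ + t) + z₂ / (s * z₂ + t) + z₃ / (s * z₃ + t) =
      (c * (z₁ * (s * z₂ + t) * (s * z₃ + t) + z₂ * (s * z₁ + t) * (s * z₃ + t)
      + z₃ * (s * z₁ + t) * (s * z₂ + t))) /
        (c * ((s * z₁ + t) * (s * z₂ + t) * (s * z₃ + t))) := by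
    generalize s * z₁ + t = w₁ at *
    generalize s * z₂ + t = w₂ at *
    generalize s * z₃ + t = w₃ at *
    field_simp
  rw [hsum, e1, e2]
  field_simp

/-- A double root kills the derivative of the cubic (`d` below). Together with the equation of the
point this says that s/t is the affine tangent slope. -/
theorem tangent (h : V.LineMeets s t c z₁ z₁ z₃) :
    t * (3 * z₁ ^ 2 + 2 * V.a₂ * z₁ * (s * z₁ + t) + V.a₄ * (s * z₁ + t) ^ 2
      + V.a₁ * (s * z₁ + t)) =
    s * (s * z₁ + t) * (-2 + V.a₁ * z₁ + V.a₃ * (s * z₁ + t)) := by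
  have e := h.zwEquation
  unfold ZWEquation at e
  have d : 3 * z₁ ^ 2 + V.a₁ * (s * z₁ + t + z₁ * s) + V.a₂ * (2 * z₁ * (s * z₁ + t) + z₁ ^ 2 * s)
      + 2 * V.a₃ * (s * z₁ + t) * s + V.a₄ * ((s * z₁ + t) ^ 2 + 2 * z₁ * (s * z₁ + t) * s)
      + 3 * V.a₆ * (s * z₁ + t) ^ 2 * s - s = 0 := by
    linear_combination 2 * z₁ * h.sum - h.sum_mul - 3 * z₁ ^ 2 * h.lead
  linear_combination (s * z₁ + t) * d + 3 * s * e

end Field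

end LineMeets

section Point

variable {F : Type*} [Field F] {V : WeierstrassCurve F}

theorem ZWEquation.equation {z w : F} (h : V.ZWEquation z w) (hw : w ≠ 0) :
    V.toAffine.Equation (z / w) (-1 / w) := by
  rw [Affine.equation_iff]
  unfold ZWEquation at h
  field_simp
  linear_combination h

theorem ZWEquation.nonsingular [V.IsElliptic] {z w : F} (h : V.ZWEquation z w) (hw : w ≠ 0) :
    V.toAffine.Nonsingular (z / w) (-1 / w) :=
  Affine.equation_iff_nonsingular.1 (h.equation hw)

variable [V.IsElliptic] [DecidableEq F]

/-- The point with coordinates `z = -x/y`, `w = -1/y`. -/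
def zwPoint (z w : F) (h : V.ZWEquation z w) : V.toAffine.Point :=
  if hw : w = 0 then 0 else .some _ _ (h.nonsingular hw)

/-- A line through the origin of the group is vertical in the affine plane (x = 1/s), so its other
two points are inverse to each other. If one of these is again the origin, then s = 0 and all three
coincide. -/
theorem LineMeets.zwPoint_add_zwPoint_of_zero {s t c z₁ z₂ : F}
    (h : V.LineMeets s t c 0 z₁ z₂) (hc : c ≠ 0) (ht : t = 0)
    (h₁ : V.ZWEquation z₁ (s * z₁ + t)) (h₂ : V.ZWEquation z₂ (s * z₂ + t))
    (k₁ : s * z₁ + t = 0 ↔ z₁ = 0) (k₂ : s * z₂ + t = 0 ↔ z₂ = 0) :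
    zwPoint _ _ h₁ + zwPoint _ _ h₂ = 0 := by
  subst ht
  have hs := h.sum
  have hm := h.sum_mul
  simp only [zero_add, mul_zero, zero_mul, add_zero, ne_eq, OfNat.ofNat_ne_zero,
    not_false_eq_true, zero_pow, zero_sub] at hs hm
  by_cases hz : z₁ = 0 ∨ z₂ = 0
  · have hs0 : s = 0 := by
      rcases hz with hz | hz <;> simpa [hz, eq_comm] using hm
    have : z₁ = 0 ∧ z₂ = 0 := by
      rw [hs0] at hs
      rcases hz with hz | hz <;> simpa [hz, hc] using hs
    have w₁ := k₁.2 this.1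
    have w₂ := k₂.2 this.2
    simp [zwPoint, w₁, w₂]
  · push Not at hz
    have w₁ := mt k₁.1 hz.1
    have w₂ := mt k₂.1 hz.2
    rw [zwPoint, dif_neg w₁, zwPoint, dif_neg w₂]
    rw [add_zero] at w₁ w₂
    have s0 : s ≠ 0 := left_ne_zero_of_mul w₁
    obtain ⟨z1, z2⟩ := hz
    apply Affine.Point.add_of_Y_eq
    · rw [add_zero, add_zero]; field_simp
    · rw [add_zero, add_zero, Affine.negY]
      field_simp
      have : s * (z₁ + z₂ - z₁ * z₂ * (V.a₁ + V.a₃ * s)) = 0 := by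
        apply mul_left_cancel₀ hc
        linear_combination s * hs - (s * V.a₁ + V.a₃ * s ^ 2) * hm
      rcases mul_eq_zero.1 this with h | h
      · exact absurd h s0
      · linear_combination -h

/-- If one point is the origin, a rotation reduces to the vertical case; otherwise t ≠ 0 and the
affine formulas with slope s/t apply. The hypotheses `k₁`, `k₂`, `k₃` exclude affine points with x =
0, so that z = 0 only at the origin. -/
theorem LineMeets.zwPoint_add {s t c z₁ z₂ z₃ : F}
    (h : V.LineMeets s t c z₁ z₂ z₃) (hc : c ≠ 0)
    (h₁ : V.ZWEquation z₁ (s * z₁ + t)) (h₂ : V.ZWEquation z₂ (s * z₂ + t))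
    (h₃ : V.ZWEquation z₃ (s * z₃ + t))
    (k₁ : s * z₁ + t = 0 ↔ z₁ = 0) (k₂ : s * z₂ + t = 0 ↔ z₂ = 0)
    (k₃ : s * z₃ + t = 0 ↔ z₃ = 0) :
    zwPoint _ _ h₁ + zwPoint _ _ h₂ = -zwPoint _ _ h₃ := by
  by_cases hz₁ : z₁ = 0
  · subst hz₁
    have w₁ := k₁.2 rfl
    have ht : t = 0 := by simpa using w₁
    have := h.zwPoint_add_zwPoint_of_zero hc ht h₂ h₃ k₂ k₃
    rw [eq_neg_iff_add_eq_zero, add_assoc, this]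
    simp [zwPoint, ht]
  by_cases hz₂ : z₂ = 0
  · subst hz₂
    have w₂ := k₂.2 rfl
    have ht : t = 0 := by simpa using w₂
    have := h.rotate.zwPoint_add_zwPoint_of_zero hc ht h₃ h₁ k₃ k₁
    rw [eq_neg_iff_add_eq_zero, add_comm, ← add_assoc, this]
    simp [zwPoint, ht]
  by_cases hz₃ : z₃ = 0
  · subst hz₃
    have w₃ := k₃.2 rfl
    have ht : t = 0 := by simpa using w₃
    have := h.rotate.rotate.zwPoint_add_zwPoint_of_zero hc ht h₁ h₂ k₁ k₂
    rw [this]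
    simp [zwPoint, ht]
  have w₁ := mt k₁.1 hz₁
  have w₂ := mt k₂.1 hz₂
  have w₃ := mt k₃.1 hz₃
  have ht : t ≠ 0 := by
    intro ht
    have := h.prod
    rw [ht] at this
    simp [hc, hz₁, hz₂, hz₃] at this
  rw [zwPoint, dif_neg w₁, zwPoint, dif_neg w₂, zwPoint, dif_neg w₃]
  have hy (z : F) (hw : s * z + t ≠ 0) :
      -1 / (s * z + t) = s / t * (z / (s * z + t)) - 1 / t := by field_simp; ring
  have hinj (z z' : F) (hw : s * z + t ≠ 0) (hw' : s * z' + t ≠ 0)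
      (e : z / (s * z + t) = z' / (s * z' + t)) : z = z' := by
    rw [div_eq_div_iff hw hw'] at e
    apply mul_left_cancel₀ ht
    linear_combination e
  have hslope : ¬(z₁ / (s * z₁ + t) = z₂ / (s * z₂ + t) ∧
      -1 / (s * z₁ + t) = V.toAffine.negY (z₂ / (s * z₂ + t)) (-1 / (s * z₂ + t))) ∧
      V.toAffine.slope (z₁ / (s * z₁ + t)) (z₂ / (s * z₂ + t)) (-1 / (s * z₁ + t))
        (-1 / (s * z₂ + t)) = s / t := by
    by_cases hx : z₁ / (s * z₁ + t) = z₂ / (s * z₂ + t)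
    · obtain rfl := hinj _ _ w₁ w₂ hx
      have tan : 3 * (z₁ / (s * z₁ + t)) ^ 2 + 2 * V.a₂ * (z₁ / (s * z₁ + t)) + V.a₄
          - V.a₁ * (-1 / (s * z₁ + t)) = s / t *
          (2 * (-1 / (s * z₁ + t)) + V.a₁ * (z₁ / (s * z₁ + t)) + V.a₃) := by
        have := h.tangent
        generalize s * z₁ + t = w at *
        field_simp
        linear_combination this
      -- If the y-derivative vanished, the tangent relation would make the x-derivative vanish too,
      -- against nonsingularity.
      have hne : 2 * (-1 / (s * z₁ + t)) + V.a₁ * (z₁ / (s * z₁ + t)) + V.a₃ ≠ 0 := by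
        intro h0
        have ns := (Affine.nonsingular_iff' _ _).1 (h₁.nonsingular w₁)
        rw [h0, mul_zero] at tan
        rcases ns.2 with h | h
        · apply h
          linear_combination -tan
        · exact h h0
      have hY : -1 / (s * z₁ + t) ≠ V.toAffine.negY (z₁ / (s * z₁ + t)) (-1 / (s * z₁ + t)) := by
        intro h0
        apply hne
        rw [Affine.negY] at h0
        linear_combination h0
      refine ⟨fun h => hY h.2, ?_⟩
      rw [Affine.slope_of_Y_ne rfl hY, tan]
      rw [div_eq_iff (sub_ne_zero.2 hY), Affine.negY]
      ring
    · refine ⟨fun h => hx h.1, ?_⟩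
      rw [Affine.slope_of_X_ne hx, div_eq_iff (sub_ne_zero.2 hx), hy z₁ w₁, hy z₂ w₂]
      ring
  rw [Affine.Point.add_some hslope.1, Affine.Point.neg_some]
  have hX : V.toAffine.addX (z₁ / (s * z₁ + t)) (z₂ / (s * z₂ + t)) (s / t) =
      z₃ / (s * z₃ + t) := by
    rw [Affine.addX]
    linear_combination h.sum_x hc ht w₁ w₂ w₃
  have hY : V.toAffine.negAddY (z₁ / (s * z₁ + t)) (z₂ / (s * z₂ + t)) (-1 / (s * z₁ + t))
      (s / t) = -1 / (s * z₃ + t) := by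
    rw [Affine.negAddY, hX, hy z₁ w₁, hy z₃ w₃]
    ring
  simp only [hslope.2, Affine.addY, hX, hY]

end Point

end WeierstrassCurve

end

noncomputable section

open MvPowerSeries Filter Topology

namespace WeierstrassCurve

/-! ### Values of the chord series at integral points -/

section Values

variable {R : Type*} [NormedCommRing R] [NormOneClass R] [IsUltrametricDist R]
variable {W : WeierstrassCurve R} {r : ℝ} (B : W.CoeffBound r)

/-- The value of the power series `w(z)`. -/
def wVal (W : WeierstrassCurve R) (z : R) : R := evalAt z 0 (W.formalWAt 0)

omit [NormOneClass R] [IsUltrametricDist R] in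
theorem CoeffBound.norm_a_le {a : R} (B : W.CoeffBound r) {l : ℕ} (h : ‖a‖ ≤ r ^ (l + 1)) :
    ‖a‖ ≤ r :=
  h.trans (by
    rw [pow_succ]
    exact mul_le_of_le_one_left B.pos.le (pow_le_one₀ B.pos.le B.lt_one.le))

omit [NormOneClass R] in
theorem norm_add_le_of_le {a b : R} (ha : ‖a‖ ≤ r) (hb : ‖b‖ ≤ r) : ‖a + b‖ ≤ r :=
  (IsUltrametricDist.norm_add_le_max a b).trans (max_le ha hb)

include B

omit [NormOneClass R] [IsUltrametricDist R] in
theorem CoeffBound.norm_mul_le' {a : R} (ha : ‖a‖ ≤ r) (b : R) : ‖a * b‖ ≤ r :=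
  (norm_mul_le_left B.norm_le_one a b).trans ha

omit [NormOneClass R] in
-- All aᵢ have norm at most r < 1, so w ↦ f(z, w) contracts by r on the whole ring. This uniqueness
-- identifies values such as w(z₃) or w of an inverse without any substitution of series into
-- series.
theorem CoeffBound.eq_of_zwEquation {z w w' : R} (h : W.ZWEquation z w)
    (h' : W.ZWEquation z w') : w = w' := by
  unfold ZWEquation at h h'
  set q := W.a₁ * z + W.a₂ * z ^ 2 + W.a₃ * (w + w') + W.a₄ * (z * (w + w'))
    + W.a₆ * (w ^ 2 + w * w' + w' ^ 2) with hq
  have key : w - w' = q * (w - w') := by rw [hq]; linear_combination h - h'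
  have hqr : ‖q‖ ≤ r :=
    norm_add_le_of_le (norm_add_le_of_le (norm_add_le_of_le (norm_add_le_of_le
      (B.norm_mul_le' (B.norm_a_le B.a₁) _) (B.norm_mul_le' (B.norm_a_le B.a₂) _))
      (B.norm_mul_le' (B.norm_a_le B.a₃) _)) (B.norm_mul_le' (B.norm_a_le B.a₄) _))
      (B.norm_mul_le' (B.norm_a_le B.a₆) _)
  have h1 : ‖w - w'‖ ≤ r * ‖w - w'‖ := by
    conv_lhs => rw [key]
    exact (_root_.norm_mul_le _ _).trans (by gcongr)
  have h2 : ‖w - w'‖ = 0 := by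
    have := norm_nonneg (w - w')
    have := B.lt_one
    nlinarith
  exact sub_eq_zero.1 (norm_eq_zero.1 h2)

variable [CompleteSpace R]

/-- The subring of power series with a bound of the form `HasWeight r k`. -/
def weightSubring (B : W.CoeffBound r) : Subring (MvPowerSeries (Fin 2) R) where
  carrier := {G | ∃ k, HasWeight r k G}
  zero_mem' := ⟨0, hasWeight_zero B.pos⟩
  one_mem' := ⟨0, hasWeight_one B.pos⟩
  neg_mem' := fun ⟨k, h⟩ => ⟨k, h.neg⟩
  mul_mem' := fun ⟨_, h⟩ ⟨_, h'⟩ => ⟨_, h.mul B.pos h'⟩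
  add_mem' := fun ⟨_, h⟩ ⟨_, h'⟩ => ⟨max _ _, (h.mono B.pos B.lt_one (le_max_left _ _)).add B.pos
    (h'.mono B.pos B.lt_one (le_max_right _ _))⟩

/-- Evaluation as a ring homomorphism. -/
def evalHom (B : W.CoeffBound r) (u v : R) : weightSubring B →+* R where
  toFun G := evalAt u v G.1
  map_one' := by
    have := evalAt_C u v (1 : R)
    rwa [map_one] at this
  map_zero' := by simp [evalAt, summandAt]
  map_add' := fun G H => by
    obtain ⟨k, h⟩ := G.2
    obtain ⟨l, h'⟩ := H.2
    exact h.evalAt_add B.pos B.lt_one B.norm_le_one h' u v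
  map_mul' := fun G H => by
    obtain ⟨k, h⟩ := G.2
    obtain ⟨l, h'⟩ := H.2
    exact h.evalAt_mul B.pos B.lt_one B.norm_le_one h' u v

omit [CompleteSpace R] in
theorem CoeffBound.C_mem (a : R) : C a ∈ weightSubring B := ⟨0, by
  have := (hasWeight_one (σ := Fin 2) (R := R) B.pos).C_mul (l := 0) (a := a) B.pos
    (by simpa using B.norm_le_one a)
  simpa using this⟩

omit [CompleteSpace R] in
theorem CoeffBound.X_mem (i : Fin 2) : (X i : MvPowerSeries (Fin 2) R) ∈ weightSubring B :=
  ⟨1, hasWeight_X B.pos i⟩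

theorem CoeffBound.zwEquation_evalAt (u v : R) (i : Fin 2) :
    W.ZWEquation (evalAt u v (X i)) (evalAt u v (W.formalWAt i)) := by
  let A (a : R) : weightSubring B := ⟨C a, B.C_mem a⟩
  let z : weightSubring B := ⟨X i, B.X_mem i⟩
  let w : weightSubring B := ⟨W.formalWAt i, 3, B.formalWAt i⟩
  have h : w = z ^ 3 + A W.a₁ * z * w + A W.a₂ * z ^ 2 * w + A W.a₃ * w ^ 2 + A W.a₄ * z * w ^ 2
      + A W.a₆ * w ^ 3 := Subtype.ext (W.formalWAt_eq i)
  have hA (a : R) : evalHom B u v (A a) = a := evalAt_C u v a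
  have := congrArg (evalHom B u v) h
  simp only [map_add, map_mul, map_pow, hA] at this
  exact this

theorem CoeffBound.zwEquation_wVal (z : R) : W.ZWEquation z (W.wVal z) := by
  have := B.zwEquation_evalAt z 0 0
  rwa [evalAt_X_zero] at this

theorem CoeffBound.evalAt_formalWAt_zero (u v : R) :
    evalAt u v (W.formalWAt 0) = W.wVal u := by
  have := B.zwEquation_evalAt u v 0
  rw [evalAt_X_zero] at this
  exact B.eq_of_zwEquation this (B.zwEquation_wVal u)

theorem CoeffBound.evalAt_formalWAt_one (u v : R) :
    evalAt u v (W.formalWAt 1) = W.wVal v := by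
  have := B.zwEquation_evalAt u v 1
  rw [evalAt_X_one] at this
  exact B.eq_of_zwEquation this (B.zwEquation_wVal v)

theorem CoeffBound.continuous_wVal : Continuous W.wVal :=
  ((B.formalWAt 0).continuous_evalAt B.pos B.lt_one B.norm_le_one).comp
    (Continuous.prodMk continuous_id continuous_const)

theorem CoeffBound.wVal_zero : W.wVal 0 = 0 :=
  B.eq_of_zwEquation (B.zwEquation_wVal 0) (by simp [ZWEquation])

theorem CoeffBound.wVal_eq_zero_iff [NoZeroDivisors R] {z : R} : W.wVal z = 0 ↔ z = 0 := by
  refine ⟨fun h => ?_, fun h => by rw [h, B.wVal_zero]⟩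
  have := B.zwEquation_wVal z
  unfold ZWEquation at this
  exact eq_zero_of_pow_eq_zero (n := 3) (by simpa [h, eq_comm] using this)

/-- The value of the formal group law. -/
def addVal (W : WeierstrassCurve R) (u v : R) : R := evalAt u v W.formalGroupLaw

/-- The formal identities are pushed through the evaluation homomorphism. The slope being a power
series, chords and tangents (u = v) are treated alike. -/
theorem CoeffBound.exists_lineMeets [IsDomain R] (u v : R) : ∃ s t c z : R, c ≠ 0 ∧
    W.LineMeets s t c u v z ∧ W.wVal u = s * u + t ∧ W.wVal v = s * v + t ∧
    W.wVal z = s * z + t ∧ W.addVal u v * (1 - W.a₁ * z - W.a₃ * W.wVal z) = -z ∧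
    1 - W.a₁ * z - W.a₃ * W.wVal z ≠ 0 := by
  let E := evalHom B u v
  let A (a : R) : weightSubring B := ⟨C a, B.C_mem a⟩
  have hA (a : R) : E (A a) = a := evalAt_C u v a
  let z₀ : weightSubring B := ⟨X 0, B.X_mem 0⟩
  have h0 : E z₀ = u := evalAt_X_zero u v
  let z₁ : weightSubring B := ⟨X 1, B.X_mem 1⟩
  have h1 : E z₁ = v := evalAt_X_one u v
  let w₀ : weightSubring B := ⟨W.formalWAt 0, 3, B.formalWAt 0⟩
  have k0 : E w₀ = W.wVal u := B.evalAt_formalWAt_zero u v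
  let w₁ : weightSubring B := ⟨W.formalWAt 1, 3, B.formalWAt 1⟩
  have k1 : E w₁ = W.wVal v := B.evalAt_formalWAt_one u v
  let s : weightSubring B := ⟨W.formalSlope, 2, B.formalSlope⟩
  let t : weightSubring B := ⟨W.formalIntercept, 3, B.formalIntercept⟩
  let c : weightSubring B := ⟨W.formalLead, 0, B.formalLead⟩
  let c' : weightSubring B := ⟨invOfUnit W.formalLead 1, 0, B.formalLead.invOfUnit B.pos⟩
  let z : weightSubring B := ⟨W.formalThird, 1, B.formalThird⟩
  let g : weightSubring B := ⟨W.formalGroupLaw, 1, B.formalGroupLaw⟩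
  let n : weightSubring B := ⟨W.formalNegDenom, 0, B.formalNegDenom⟩
  let n' : weightSubring B := ⟨invOfUnit W.formalNegDenom 1, 0, B.formalNegDenom.invOfUnit B.pos⟩
  have hgE : E g = W.addVal u v := rfl
  have e0 : w₀ = s * z₀ + t := Subtype.ext W.formalWAt_zero_eq
  have e1 : w₁ = s * z₁ + t := Subtype.ext W.formalWAt_one_eq
  have ec : c = 1 + A W.a₂ * s + A W.a₄ * s ^ 2 + A W.a₆ * s ^ 3 := rfl
  have ecc : c * c' = 1 := Subtype.ext W.formalLead_mul_inv
  have en : n = 1 - A W.a₁ * z - A W.a₃ * (s * z + t) := rfl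
  have enn : n * n' = 1 :=
    Subtype.ext (mul_invOfUnit W.formalNegDenom 1 (by simp [constantCoeff_formalNegDenom]))
  have eg : g * n = -z := Subtype.ext W.formalGroupLaw_mul_formalNegDenom
  have es : c * (z₀ + z₁ + z) = -(A W.a₁ * s + A W.a₂ * t + A W.a₃ * s ^ 2
      + 2 * A W.a₄ * s * t + 3 * A W.a₆ * s ^ 2 * t) := Subtype.ext W.formalLead_mul_sum
  have em : c * (z₀ * z₁ + z₀ * z + z₁ * z) = A W.a₁ * t + 2 * A W.a₃ * s * t
      + A W.a₄ * t ^ 2 + 3 * A W.a₆ * s * t ^ 2 - s := Subtype.ext W.formalLead_mul_sum_mul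
  have ep : c * (z₀ * z₁ * z) = t - A W.a₃ * t ^ 2 - A W.a₆ * t ^ 3 :=
    Subtype.ext W.formalLead_mul_prod
  replace e0 := congrArg E e0
  replace e1 := congrArg E e1
  replace ec := congrArg E ec
  replace ecc := congrArg E ecc
  replace en := congrArg E en
  replace enn := congrArg E enn
  replace eg := congrArg E eg
  replace es := congrArg E es
  replace em := congrArg E em
  replace ep := congrArg E ep
  simp only [map_add, map_mul, map_sub, map_neg, map_pow, map_one, map_ofNat, hA, h0, h1, k0, k1,
    hgE] at e0 e1 ec ecc en enn eg es em ep
  have hL : W.LineMeets (E s) (E t) (E c) u v (E z) := ⟨ec, es, em, ep⟩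
  -- Vieta puts the third point of the line on the curve, and uniqueness of w identifies its second
  -- coordinate.
  have hz : W.wVal (E z) = E s * E z + E t :=
    B.eq_of_zwEquation (B.zwEquation_wVal _) hL.rotate.rotate.zwEquation
  refine ⟨E s, E t, E c, E z, left_ne_zero_of_mul_eq_one ecc, hL, e0, e1, hz, ?_, ?_⟩
  · rw [hz, ← en, eg]
  · rw [hz, ← en]; exact left_ne_zero_of_mul_eq_one enn

/-- The factor 1 - a₁z - a₃w is a unit because ‖a₁z + a₃w‖ < 1. Dividing (-z, -w) by it gives
another solution of the equation, to which uniqueness of w applies. -/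
theorem CoeffBound.exists_neg (z : R) : ∃ n : R, n * (1 - W.a₁ * z - W.a₃ * W.wVal z) = -z ∧
    W.wVal n * (1 - W.a₁ * z - W.a₃ * W.wVal z) = -W.wVal z := by
  have hlt : ‖W.a₁ * z + W.a₃ * W.wVal z‖ < 1 :=
    (norm_add_le_of_le (B.norm_mul_le' (B.norm_a_le B.a₁) _)
      (B.norm_mul_le' (B.norm_a_le B.a₃) _)).trans_lt B.lt_one
  obtain ⟨N', h⟩ := (isUnit_one_sub_of_norm_lt_one hlt).exists_right_inv
  have hN : (1 - W.a₁ * z - W.a₃ * W.wVal z) * N' = 1 := by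
    linear_combination h
  have e := B.zwEquation_wVal z
  have hw : W.ZWEquation (-z * N') (-W.wVal z * N') := by
    unfold ZWEquation at e ⊢
    linear_combination (-N' ^ 3) * e + (N' ^ 2 * W.wVal z + N' * W.wVal z) * hN
  refine ⟨-z * N', by linear_combination (-z) * hN, ?_⟩
  rw [B.eq_of_zwEquation (B.zwEquation_wVal _) hw]
  linear_combination (-W.wVal z) * hN

end Values

end WeierstrassCurve

end

noncomputable section

open Filter Topology

/-! ### Discreteness of the norm, ramification, and the choice of r -/

section Padic

variable (p : ℕ) [Fact p.Prime] (K : Type*) [NormedField K] [NormedAlgebra ℚ_[p] K]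

namespace padicIntegers

include p in
theorem isUltrametricDist_field : IsUltrametricDist K := IsUltrametricDist.of_normedAlgebra ℚ_[p]

instance : IsUltrametricDist (padicIntegers p K) where
  dist_triangle_max x y z :=
    (isUltrametricDist_field p K).dist_triangle_max (x : K) (y : K) (z : K)

variable {p K}

theorem norm_le_one (x : padicIntegers p K) : ‖x‖ ≤ 1 := x.2

theorem norm_coe (x : padicIntegers p K) : ‖(x : K)‖ = ‖x‖ := rfl

theorem exists_of_norm_le_one {x : K} (hx : ‖x‖ ≤ 1) : ∃ y : padicIntegers p K, (y : K) = x :=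
  ⟨⟨x, hx⟩, rfl⟩

theorem isUnit_iff {x : padicIntegers p K} : IsUnit x ↔ ‖x‖ = 1 := by
  constructor
  · intro h
    obtain ⟨y, hy⟩ := h.exists_right_inv
    have h1 : ‖x‖ * ‖y‖ = 1 := by rw [← norm_mul, hy, norm_one]
    have := norm_le_one x
    have := norm_le_one y
    have := norm_nonneg x
    nlinarith
  · intro h
    have h' : ‖(x : K)‖ = 1 := h
    have hx : (x : K) ≠ 0 := by
      intro h0; rw [h0, norm_zero] at h'; exact zero_ne_one h'
    obtain ⟨y, hy⟩ := exists_of_norm_le_one (p := p) (x := (x : K)⁻¹) (by rw [norm_inv, h']; simp)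
    refine IsUnit.of_mul_eq_one y (Subtype.ext ?_)
    change (x : K) * y = 1
    rw [hy, mul_inv_cancel₀ hx]

theorem mem_maximalIdeal_iff {x : padicIntegers p K} :
    x ∈ IsLocalRing.maximalIdeal (padicIntegers p K) ↔ ‖x‖ < 1 := by
  rw [IsLocalRing.mem_maximalIdeal, mem_nonunits_iff, isUnit_iff]
  exact ⟨fun h => lt_of_le_of_ne (norm_le_one x) h, fun h => h.ne⟩

theorem norm_algebraMap (x : ℤ_[p]) : ‖algebraMap ℤ_[p] (padicIntegers p K) x‖ = ‖x‖ := by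
  change ‖algebraMap ℚ_[p] K (x : ℚ_[p])‖ = _
  rw [norm_algebraMap']; rfl

theorem norm_natCast (n : ℕ) : ‖(n : padicIntegers p K)‖ = ‖(n : ℚ_[p])‖ := by
  have := norm_algebraMap (K := K) (n : ℤ_[p])
  rw [map_natCast] at this
  rw [this, PadicInt.norm_def, PadicInt.coe_natCast]

theorem norm_p : ‖(p : padicIntegers p K)‖ = (p : ℝ)⁻¹ := by
  rw [norm_natCast, Padic.norm_p]

theorem norm_coe_p : ‖(p : K)‖ = (p : ℝ)⁻¹ := by
  rw [← norm_p (K := K), ← norm_coe]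
  simp

variable [FiniteDimensional ℚ_[p] K]

variable (p K) in
include p in
theorem properSpace : ProperSpace K := FiniteDimensional.proper ℚ_[p] K

instance : CompleteSpace (padicIntegers p K) := by
  have := properSpace p K
  exact (isClosed_le continuous_norm continuous_const : IsClosed {x : K | ‖x‖ ≤ 1}).completeSpace_coe

instance : CompactSpace (padicIntegers p K) := by
  have := properSpace p K
  have h : IsCompact {x : K | ‖x‖ ≤ 1} := by
    have := isCompact_closedBall (0 : K) 1
    simpa [Metric.closedBall, dist_zero_right] using this
  exact isCompact_iff_compactSpace.1 h

variable (p K) in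
-- The open unit ball is closed in the compact ring 𝓞_K, so the norm attains its maximum there; it
-- is nonzero because p lies in the ball.
theorem exists_uniformizer : ∃ π : padicIntegers p K, 0 < ‖π‖ ∧ ‖π‖ < 1 ∧
    ∀ x : padicIntegers p K, ‖x‖ < 1 → ‖x‖ ≤ ‖π‖ := by
  have hp : 1 < (p : ℝ) := by exact_mod_cast (Fact.out : p.Prime).one_lt
  have hc : IsCompact {x : padicIntegers p K | ‖x‖ < 1} := by
    have : {x : padicIntegers p K | ‖x‖ < 1} = Metric.ball 0 1 := by
      ext; simp
    rw [this]
    exact (IsUltrametricDist.isClosed_ball _ _).isCompact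
  obtain ⟨π, hπ, hmax⟩ := hc.exists_isMaxOn ⟨(p : padicIntegers p K), by
    change ‖(p : padicIntegers p K)‖ < 1
    rw [norm_p]; exact inv_lt_one_of_one_lt₀ hp⟩ continuous_norm.continuousOn
  refine ⟨π, ?_, hπ, fun x hx => hmax hx⟩
  have : ‖(p : padicIntegers p K)‖ ≤ ‖π‖ := hmax (by
    change ‖(p : padicIntegers p K)‖ < 1
    rw [norm_p]; exact inv_lt_one_of_one_lt₀ hp)
  rw [norm_p] at this
  exact lt_of_lt_of_le (by positivity) this

omit [FiniteDimensional ℚ_[p] K] in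
theorem dvd_of_norm_le {x y : padicIntegers p K} (h : ‖x‖ ≤ ‖y‖) : y ∣ x := by
  by_cases hy : y = 0
  · subst hy
    rw [norm_zero, norm_le_zero_iff] at h
    rw [h]
  · have hy' : (y : K) ≠ 0 := by simpa using hy
    obtain ⟨z, hz⟩ := exists_of_norm_le_one (p := p) (x := (x : K) / y) (by
      rw [norm_div]; exact div_le_one_of_le₀ h (norm_nonneg _))
    refine ⟨z, Subtype.ext ?_⟩
    change (x : K) = y * z
    rw [hz]; field_simp

omit [FiniteDimensional ℚ_[p] K] in
theorem exists_norm_eq_pow {π : padicIntegers p K} (h0 : 0 < ‖π‖) (h1 : ‖π‖ < 1)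
    (hmax : ∀ x : padicIntegers p K, ‖x‖ < 1 → ‖x‖ ≤ ‖π‖) {x : padicIntegers p K} (hx : x ≠ 0) :
    ∃ n : ℕ, ‖x‖ = ‖π‖ ^ n := by
  obtain ⟨n, hn1, hn2⟩ := exists_nat_pow_near_of_lt_one (norm_pos_iff.2 hx) (norm_le_one x) h0 h1
  obtain ⟨y, rfl⟩ := dvd_of_norm_le (x := x) (y := π ^ n) (by rwa [norm_pow])
  rw [norm_mul, norm_pow] at hn1
  have hy : ‖y‖ = 1 := by
    by_contra hne
    have := hmax y (lt_of_le_of_ne (norm_le_one y) hne)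
    have : ‖π‖ ^ n * ‖y‖ ≤ ‖π‖ ^ n * ‖π‖ := by gcongr
    rw [pow_succ] at hn1
    linarith
  exact ⟨n, by rw [norm_mul, norm_pow, hy, mul_one]⟩

omit [FiniteDimensional ℚ_[p] K] in
-- Writing ‖p‖ = ‖π‖ ^ n, the ideal (p) lies in the k-th power of the maximal ideal exactly when k ≤
-- n. So the supremum defining e is n.
theorem le_norm_p {π : padicIntegers p K} (h0 : 0 < ‖π‖) (h1 : ‖π‖ < 1)
    (hmax : ∀ x : padicIntegers p K, ‖x‖ < 1 → ‖x‖ ≤ ‖π‖) :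
    ‖π‖ ^ padicRamificationIdx p K ≤ (p : ℝ)⁻¹ := by
  have hp0 : (p : padicIntegers p K) ≠ 0 := by
    rw [← norm_ne_zero_iff, norm_p]
    have := (Fact.out : p.Prime).pos
    positivity
  obtain ⟨n, hn⟩ := exists_norm_eq_pow h0 h1 hmax hp0
  have hm : IsLocalRing.maximalIdeal (padicIntegers p K) = Ideal.span {π} := by
    ext x
    rw [mem_maximalIdeal_iff, Ideal.mem_span_singleton]
    constructor
    · exact fun h => dvd_of_norm_le (hmax x h)
    · rintro ⟨y, rfl⟩
      rw [norm_mul]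
      exact lt_of_le_of_lt (mul_le_of_le_one_right h0.le (norm_le_one y)) h1
  have key (k : ℕ) : Ideal.map (algebraMap ℤ_[p] (padicIntegers p K))
      (IsLocalRing.maximalIdeal ℤ_[p]) ≤ IsLocalRing.maximalIdeal (padicIntegers p K) ^ k ↔
      k ≤ n := by
    rw [PadicInt.maximalIdeal_eq_span_p, Ideal.map_span, Set.image_singleton, map_natCast, hm,
      Ideal.span_singleton_pow, Ideal.span_singleton_le_span_singleton]
    constructor
    · rintro ⟨y, hy⟩
      have h2 : ‖π‖ ^ n ≤ ‖π‖ ^ k := by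
        rw [← hn, hy, norm_mul, norm_pow]
        exact mul_le_of_le_one_right (by positivity) (norm_le_one y)
      by_contra hlt
      exact absurd (pow_lt_pow_right_of_lt_one₀ h0 h1 (not_le.1 hlt)) (not_lt.2 h2)
    · intro hk
      apply dvd_of_norm_le
      rw [hn, norm_pow]
      exact pow_le_pow_of_le_one h0.le h1.le hk
  have he : padicRamificationIdx p K = n := by
    rw [padicRamificationIdx, Ideal.ramificationIdx']
    simp only [key]
    exact csSup_Iic
  rw [he, ← hn, norm_p]

/-- The 6 in 6e < p - 1 is the largest weight, that of a₆: with r ^ 6 = ‖π‖ one gets r ^ (p - 1) < r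
^ (6e) = ‖π‖ ^ e ≤ 1/p. -/
theorem exists_coeffBound (W : WeierstrassCurve (padicIntegers p K))
    (h₁ : W.a₁ ∈ IsLocalRing.maximalIdeal (padicIntegers p K))
    (h₂ : W.a₂ ∈ IsLocalRing.maximalIdeal (padicIntegers p K))
    (h₃ : W.a₃ ∈ IsLocalRing.maximalIdeal (padicIntegers p K))
    (h₄ : W.a₄ ∈ IsLocalRing.maximalIdeal (padicIntegers p K))
    (h₆ : W.a₆ ∈ IsLocalRing.maximalIdeal (padicIntegers p K)) :
    ∃ r, W.CoeffBound r ∧ (6 * padicRamificationIdx p K < p - 1 → r ^ (p - 1) < (p : ℝ)⁻¹) := by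
  obtain ⟨π, h0, h1, hmax⟩ := exists_uniformizer p K
  obtain ⟨r, hr0, hr⟩ : ∃ r : ℝ, 0 < r ∧ r ^ 6 = ‖π‖ :=
    ⟨‖π‖ ^ ((1 : ℝ) / 6), by positivity, by
      rw [← Real.rpow_natCast, ← Real.rpow_mul h0.le]; norm_num⟩
  have hr1 : r < 1 := by
    by_contra h
    have := one_le_pow₀ (n := 6) (not_lt.1 h)
    linarith
  have hle {a : padicIntegers p K} (ha : a ∈ IsLocalRing.maximalIdeal (padicIntegers p K)) {i : ℕ}
      (hi : i ≤ 6) : ‖a‖ ≤ r ^ i :=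
    (hmax a (mem_maximalIdeal_iff.1 ha)).trans
      (hr ▸ pow_le_pow_of_le_one hr0.le hr1.le hi)
  refine ⟨r, ⟨hr0, hr1, norm_le_one, hle h₁ (by norm_num), hle h₂ (by norm_num),
    hle h₃ (by norm_num), hle h₄ (by norm_num), hle h₆ le_rfl⟩, fun he => ?_⟩
  calc r ^ (p - 1) < r ^ (6 * padicRamificationIdx p K) :=
        pow_lt_pow_right_of_lt_one₀ hr0 hr1 he
    _ = ‖π‖ ^ padicRamificationIdx p K := by rw [pow_mul, hr]
    _ ≤ _ := le_norm_p h0 h1 hmax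

end padicIntegers

end Padic

end

noncomputable section

open Filter Topology

namespace WeierstrassCurve

/-! ### Continuity of the parameter for the projective topology -/

section Topology

variable {F : Type*} [Field F] {V : WeierstrassCurve F}

theorem zParam_eq (P : V.toAffine.Point) : zParam P = -pointCoords P 0 / pointCoords P 1 := by
  cases P <;> simp [zParam, pointCoords]

theorem zwPoint_coords_ne_zero (z w : F) : ![z, -1, w] ≠ 0 := fun h => by
  simpa using congrFun h 1

/-- The coordinates (z : -1 : w) cover the origin as well, so continuity in z needs no change of
chart. -/
theorem pointToProj_zwPoint [V.IsElliptic] [DecidableEq F] {z w : F} (h : V.ZWEquation z w)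
    (hz : w = 0 → z = 0) :
    pointToProj (zwPoint z w h) = Projectivization.mk F ![z, -1, w] (zwPoint_coords_ne_zero z w) := by
  unfold pointToProj
  rw [Projectivization.mk_eq_mk_iff']
  by_cases hw : w = 0
  · refine ⟨-1, ?_⟩
    obtain rfl := hz hw
    subst hw
    ext i
    fin_cases i <;> simp [zwPoint, pointCoords, Affine.Point.zero_def]
  · refine ⟨w⁻¹, ?_⟩
    ext i
    fin_cases i <;> simp [zwPoint, hw, pointCoords] <;> field_simp

theorem zParam_zwPoint [V.IsElliptic] [DecidableEq F] {z w : F} (h : V.ZWEquation z w)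
    (hz : w = 0 → z = 0) : zParam (zwPoint z w h) = z := by
  by_cases hw : w = 0
  · simp [zwPoint, hw, hz hw, zParam, Affine.Point.zero_def]
  · simp only [zwPoint, hw, dite_false, zParam]
    field_simp

/-- The points that do not lie on `Y = 0`. -/
def offYAxis (V : WeierstrassCurve F) : Set V.toAffine.Point := {P | pointCoords P 1 ≠ 0}

theorem continuousOn_zParam [TopologicalSpace F] [IsTopologicalDivisionRing F] [T1Space F] :
    ContinuousOn (zParam (V := V)) (offYAxis V) := by
  rw [continuousOn_iff']
  intro U hU
  -- The condition is invariant under scaling, so it does not depend on the representative and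
  -- openness can be tested on F³ \ {0}.
  let S : Set (Projectivization F (Fin 3 → F)) := {x | x.rep 1 ≠ 0 ∧ -x.rep 0 / x.rep 1 ∈ U}
  have hmem (v : Fin 3 → F) (hv : v ≠ 0) :
      Projectivization.mk F v hv ∈ S ↔ v 1 ≠ 0 ∧ -v 0 / v 1 ∈ U := by
    obtain ⟨a, ha⟩ := Projectivization.exists_smul_eq_mk_rep F v hv
    have hi (i : Fin 3) : (Projectivization.mk F v hv).rep i = a * v i := by
      rw [← ha]; rfl
    simp only [S, Set.mem_ofPred_eq, hi]
    have : -(a * v 0) / (a * v 1) = -v 0 / v 1 := by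
      rw [← mul_neg, mul_div_mul_left _ _ a.ne_zero]
    rw [this]
    simp
  let _ : TopologicalSpace (Projectivization F (Fin 3 → F)) := TopologicalSpace.coinduced
    (fun v : {v : Fin 3 → F // v ≠ 0} => Projectivization.mk F v.1 v.2) inferInstance
  refine ⟨pointToProj ⁻¹' S, ?_, ?_⟩
  · refine isOpen_induced_iff.2 ⟨S, isOpen_coinduced.2 ?_, rfl⟩
    have hpre : (fun v : {v : Fin 3 → F // v ≠ 0} => Projectivization.mk F v.1 v.2) ⁻¹' S =
        {v | v.1 1 ≠ 0} ∩ (fun v => -v.1 0 / v.1 1) ⁻¹' U := by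
      ext v; exact hmem v.1 v.2
    rw [hpre]
    have hc (i : Fin 3) : Continuous fun v : {v : Fin 3 → F // v ≠ 0} => v.1 i :=
      (continuous_apply i).comp continuous_subtype_val
    refine ContinuousOn.isOpen_inter_preimage ?_ (isOpen_ne.preimage (hc 1)) hU
    exact (hc 0).neg.continuousOn.div (hc 1).continuousOn fun v hv => hv
  · ext P
    have := hmem (pointCoords P) (pointCoords_ne_zero P)
    simp only [Set.mem_inter_iff, Set.mem_preimage, zParam_eq]
    constructor
    · exact fun h => ⟨(hmem (pointCoords P) (pointCoords_ne_zero P)).2 ⟨h.2, h.1⟩, h.2⟩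
    · exact fun h => ⟨(this.1 h.1).2, h.2⟩

end Topology

/-! ### The parametrization of points by z and its compatibility with addition -/

section Points

variable {p : ℕ} [Fact p.Prime] {K : Type*} [NormedField K] [NormedAlgebra ℚ_[p] K]
  [FiniteDimensional ℚ_[p] K] [DecidableEq K] {W : WeierstrassCurve (padicIntegers p K)}
  [(W.baseChange K).IsElliptic] {r : ℝ}

omit [FiniteDimensional ℚ_[p] K] [DecidableEq K] [(W.baseChange K).IsElliptic] in
theorem zwEquation_coe_iff {z w : padicIntegers p K} :
    (W.baseChange K).ZWEquation (z : K) (w : K) ↔ W.ZWEquation z w := by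
  unfold ZWEquation
  rw [← Subtype.coe_inj]
  rfl

/-- The point of the curve with given parameter `z`. -/
def pointOf (B : W.CoeffBound r) (z : padicIntegers p K) : (W.baseChange K).toAffine.Point :=
  zwPoint (z : K) (W.wVal z : K) (zwEquation_coe_iff.2 (B.zwEquation_wVal z))

variable (B : W.CoeffBound r)
include B

omit [DecidableEq K] [(W.baseChange K).IsElliptic] in
theorem CoeffBound.coe_wVal_eq_zero_iff {z : padicIntegers p K} :
    (W.wVal z : K) = 0 ↔ (z : K) = 0 := by
  simpa using B.wVal_eq_zero_iff (z := z)

theorem zParam_pointOf (z : padicIntegers p K) : zParam (pointOf B z) = (z : K) :=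
  zParam_zwPoint _ B.coe_wVal_eq_zero_iff.1

theorem pointOf_zero : pointOf B 0 = 0 := by
  simp [pointOf, zwPoint, B.wVal_zero]

theorem pointOf_neg {z n : padicIntegers p K}
    (h : n * (1 - W.a₁ * z - W.a₃ * W.wVal z) = -z)
    (hw : W.wVal n * (1 - W.a₁ * z - W.a₃ * W.wVal z) = -W.wVal z) :
    pointOf B n = -pointOf B z := by
  by_cases hz : z = 0
  · subst hz
    have : n = 0 := by simpa [B.wVal_zero] using h
    rw [this, pointOf_zero, neg_zero]
  · have w0 : (W.wVal z : K) ≠ 0 := fun h0 => hz (by simpa using B.coe_wVal_eq_zero_iff.1 h0)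
    have h' := congrArg (Subtype.val : padicIntegers p K → K) h
    have hw' := congrArg (Subtype.val : padicIntegers p K → K) hw
    change (n : K) * (1 - W.a₁ * z - W.a₃ * W.wVal z) = -z at h'
    change (W.wVal n : K) * (1 - W.a₁ * z - W.a₃ * W.wVal z) = -W.wVal z at hw'
    have n0 : (W.wVal n : K) ≠ 0 := fun h0 => by
      rw [h0, zero_mul, eq_comm, neg_eq_zero] at hw'
      exact w0 hw'
    set N : K := 1 - W.a₁ * z - W.a₃ * W.wVal z with hN
    have N0 : N ≠ 0 := fun h0 => by
      rw [h0, mul_zero, eq_comm, neg_eq_zero] at hw'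
      exact w0 hw'
    have e1 : (n : K) / W.wVal n = z / W.wVal z := by
      rw [div_eq_div_iff n0 w0]
      apply mul_right_cancel₀ N0
      linear_combination (W.wVal z : K) * h' - z * hw'
    have e2 : -1 / (W.wVal n : K) =
        (W.baseChange K).toAffine.negY (z / W.wVal z) (-1 / W.wVal z) := by
      have : -1 / (W.wVal n : K) = N / W.wVal z := by
        rw [div_eq_div_iff n0 w0]
        linear_combination -hw'
      rw [this, hN, Affine.negY]
      change _ = -(-1 / (W.wVal z : K)) - (W.a₁ : K) * (z / W.wVal z) - (W.a₃ : K)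
      field_simp
    rw [pointOf, zwPoint, dif_neg n0, pointOf, zwPoint, dif_neg w0, Affine.Point.neg_some]
    simp only [e1, e2]

/-- The points with parameters u, v and z₃ are collinear, so the first two add up to the inverse of
the third, whose parameter is F(u, v). -/
theorem pointOf_add (u v : padicIntegers p K) :
    pointOf B u + pointOf B v = pointOf B (W.addVal u v) := by
  obtain ⟨s, t, c, z, hc, hL, hu, hv, hz, hF, hN⟩ := B.exists_lineMeets u v
  obtain ⟨n, hn, hwn⟩ := B.exists_neg z
  -- Both sides times 1 - a₁z - a₃w(z) equal -z, and this factor is nonzero.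
  have : W.addVal u v = n := mul_right_cancel₀ hN (hF.trans hn.symm)
  rw [this, pointOf_neg B hn hwn]
  have k (x : padicIntegers p K) := B.coe_wVal_eq_zero_iff (z := x)
  have e (x : padicIntegers p K) := zwEquation_coe_iff.2 (B.zwEquation_wVal x)
  have hL' := hL.map (algebraMap (padicIntegers p K) K)
  have hc' : (c : K) ≠ 0 := by simpa using hc
  have hu' : (W.wVal u : K) = s * u + t := congrArg Subtype.val hu
  have hv' : (W.wVal v : K) = s * v + t := congrArg Subtype.val hv
  have hz' : (W.wVal z : K) = s * z + t := congrArg Subtype.val hz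
  have ku := k u
  have kv := k v
  have kz := k z
  have eu := e u
  have ev := e v
  have ez := e z
  unfold pointOf
  simp only [hu', hv', hz'] at ku kv kz eu ev ez ⊢
  exact LineMeets.zwPoint_add (V := W.baseChange K) (z₁ := (u : K)) (z₂ := (v : K)) (z₃ := (z : K))
    hL' hc' eu ev ez ku kv kz

theorem exists_pointOf_neg (z : padicIntegers p K) : ∃ n, pointOf B n = -pointOf B z := by
  obtain ⟨n, hn, hwn⟩ := B.exists_neg z
  exact ⟨n, pointOf_neg B hn hwn⟩

theorem pointOf_injective : Function.Injective (pointOf B) := fun z z' h => by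
  have := congrArg zParam h
  rw [zParam_pointOf, zParam_pointOf] at this
  exact Subtype.ext this

/-- The range of `pointOf` as a subgroup. -/
def goodPoints : AddSubgroup (W.baseChange K).toAffine.Point where
  carrier := Set.range (pointOf B)
  zero_mem' := ⟨0, pointOf_zero B⟩
  add_mem' := by
    rintro _ _ ⟨u, rfl⟩ ⟨v, rfl⟩
    exact ⟨_, (pointOf_add B u v).symm⟩
  neg_mem' := by
    rintro _ ⟨u, rfl⟩
    exact exists_pointOf_neg B u

theorem pointCoords_pointOf_ne_zero (z : padicIntegers p K) :
    pointCoords (pointOf B z) 1 ≠ 0 := by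
  unfold pointOf zwPoint
  split_ifs with h
  · simp [pointCoords]
  · simp [pointCoords, h]

theorem continuous_pointOf : Continuous (pointOf B) := by
  let _ : TopologicalSpace (Projectivization K (Fin 3 → K)) := TopologicalSpace.coinduced
    (fun v : {v : Fin 3 → K // v ≠ 0} => Projectivization.mk K v.1 v.2) inferInstance
  refine continuous_induced_rng.2 ?_
  have h : pointToProj ∘ pointOf B =
      (fun v : {v : Fin 3 → K // v ≠ 0} => Projectivization.mk K v.1 v.2) ∘
      fun z : padicIntegers p K => ⟨![(z : K), -1, (W.wVal z : K)], zwPoint_coords_ne_zero _ _⟩ := by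
    ext z : 1
    exact pointToProj_zwPoint _ B.coe_wVal_eq_zero_iff.1
  rw [h]
  refine Continuous.comp continuous_coinduced_rng (Continuous.subtype_mk ?_ _)
  refine continuous_pi fun i => ?_
  fin_cases i
  · exact continuous_subtype_val
  · exact continuous_const
  · exact continuous_subtype_val.comp B.continuous_wVal

/-- The parameter as a homeomorphism. -/
def goodPointsHomeomorph : padicIntegers p K ≃ₜ goodPoints B where
  toEquiv := Equiv.ofInjective (pointOf B) (pointOf_injective B)
  continuous_toFun := Continuous.subtype_mk (continuous_pointOf B) _
  continuous_invFun := by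
    rw [continuous_induced_rng]
    have hs (P : goodPoints B) : P.1 ∈ offYAxis (W.baseChange K) := by
      obtain ⟨_, z, rfl⟩ := P
      exact pointCoords_pointOf_ne_zero B z
    refine (continuousOn_zParam.comp_continuous continuous_subtype_val hs).congr fun P => ?_
    obtain ⟨_, z, rfl⟩ := P
    refine (zParam_pointOf B z).trans (congrArg Subtype.val ?_)
    exact ((Equiv.ofInjective (pointOf B) (pointOf_injective B)).symm_apply_apply z).symm

end Points

end WeierstrassCurve

end

noncomputable section

open Filter Topology

namespace WeierstrassCurve

/-! ### Points with nonsingular reduction -/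

section Reduction

variable {p : ℕ} [Fact p.Prime] {K : Type*} [NormedField K] [NormedAlgebra ℚ_[p] K]
  {W : WeierstrassCurve (padicIntegers p K)} {r : ℝ}

theorem CoeffBound.residue_eq_zero (B : W.CoeffBound r) {a : padicIntegers p K} {l : ℕ}
    (h : ‖a‖ ≤ r ^ (l + 1)) : IsLocalRing.residue (padicIntegers p K) a = 0 := by
  rw [IsLocalRing.residue_eq_zero_iff, padicIntegers.mem_maximalIdeal_iff]
  exact (B.norm_a_le h).trans_lt B.lt_one

/-- The reduction is the cusp Y²Z = X³. If Y = 0 then X = 0 and all partial derivatives vanish; if Y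
≠ 0 the derivative Y² is nonzero in every characteristic. -/
theorem CoeffBound.nonsingular_residue_iff (B : W.CoeffBound r)
    (v : Fin 3 → IsLocalRing.ResidueField (padicIntegers p K)) :
    (W.map (IsLocalRing.residue (padicIntegers p K))).toProjective.Nonsingular v ↔
      v 1 ^ 2 * v 2 = v 0 ^ 3 ∧ v 1 ≠ 0 := by
  have e1 := B.residue_eq_zero B.a₁
  have e2 := B.residue_eq_zero B.a₂
  have e3 := B.residue_eq_zero B.a₃
  have e4 := B.residue_eq_zero B.a₄
  have e6 := B.residue_eq_zero B.a₆
  rw [Projective.nonsingular_iff, Projective.equation_iff]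
  simp only [map_a₁, map_a₂, map_a₃, map_a₄, map_a₆, e1, e2, e3, e4, e6, zero_mul, mul_zero,
    add_zero, sub_zero, zero_sub]
  rw [sub_eq_zero]
  refine and_congr_right fun h => ⟨fun h' h1 => ?_, fun h1 => Or.inr (Or.inr (pow_ne_zero 2 h1))⟩
  have h0 : v 0 = 0 := by
    rw [h1] at h
    rw [zero_pow two_ne_zero, zero_mul] at h
    exact eq_zero_of_pow_eq_zero h.symm
  simp [h0, h1] at h'

variable [FiniteDimensional ℚ_[p] K] [DecidableEq K] [(W.baseChange K).IsElliptic]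

/-- Nonsingular reduction means that the Y-coordinate is a unit. Scaling it to -1 gives integral (z,
w) on the curve, and uniqueness forces w = w(z). -/
theorem coe_goodPoints (B : W.CoeffBound r) :
    (goodPoints B : Set (W.baseChange K).toAffine.Point) = W.nonsingularReduction K := by
  apply Set.Subset.antisymm
  · rintro _ ⟨z, rfl⟩
    refine ⟨![z, -1, W.wVal z], ⟨1, by simp⟩, ?_, ?_⟩
    · by_cases hz : z = 0
      · subst hz
        refine ⟨-1, fun i => ?_⟩
        rw [pointOf_zero]
        fin_cases i <;> simp [pointCoords, B.wVal_zero]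
      · have w0 : (W.wVal z : K) ≠ 0 := fun h0 => hz (by simpa using B.coe_wVal_eq_zero_iff.1 h0)
        refine ⟨Units.mk0 _ w0, fun i => ?_⟩
        rw [pointOf, zwPoint, dif_neg w0]
        fin_cases i
        · change (z : K) = W.wVal z * (z / W.wVal z)
          field_simp
        · change ((-1 : padicIntegers p K) : K) = W.wVal z * (-1 / W.wVal z)
          field_simp
          simp
        · change (W.wVal z : K) = W.wVal z * 1
          rw [mul_one]
    · rw [B.nonsingular_residue_iff]
      have e := congrArg (IsLocalRing.residue (padicIntegers p K)) (B.zwEquation_wVal z)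
      simp only [map_add, map_mul, map_pow, B.residue_eq_zero B.a₁, B.residue_eq_zero B.a₂,
        B.residue_eq_zero B.a₃, B.residue_eq_zero B.a₄, B.residue_eq_zero B.a₆, zero_mul,
        add_zero] at e
      simp [e]
  · rintro P ⟨v, -, ⟨c, hc⟩, hns⟩
    rw [B.nonsingular_residue_iff] at hns
    have hu : IsUnit (v 1) := (IsLocalRing.residue_ne_zero_iff_isUnit _).1 hns.2
    obtain ⟨y', hy'⟩ := hu.exists_right_inv
    cases P with
    | zero => exact ⟨0, pointOf_zero B⟩
    | some x y h =>
      have h0 : (v 0 : K) = c * x := hc 0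
      have h1 : (v 1 : K) = c * y := hc 1
      have h2 : (v 2 : K) = c * 1 := hc 2
      have hyK : (v 1 : K) * y' = 1 := congrArg Subtype.val hy'
      have c0 : (c : K) ≠ 0 := c.ne_zero
      have y0 : y ≠ 0 := by
        rintro rfl
        rw [h1, mul_zero, zero_mul] at hyK
        exact zero_ne_one hyK
      have ey : (y' : K) = 1 / (c * y) := by
        rw [h1] at hyK
        field_simp
        linear_combination hyK
      have ez : ((-v 0 * y' : padicIntegers p K) : K) = -x / y := by
        change -(v 0 : K) * y' = _
        rw [h0, ey]; field_simp
      have ew : ((-v 2 * y' : padicIntegers p K) : K) = -1 / y := by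
        change -(v 2 : K) * y' = _
        rw [h2, ey]; field_simp
      have heq : W.ZWEquation (-v 0 * y') (-v 2 * y') := by
        rw [← zwEquation_coe_iff, ez, ew]
        have := (Affine.equation_iff _ _).1 h.1
        unfold ZWEquation
        field_simp
        linear_combination -this
      have hw := B.eq_of_zwEquation (B.zwEquation_wVal _) heq
      refine ⟨-v 0 * y', ?_⟩
      have w0 : (W.wVal (-v 0 * y') : K) ≠ 0 := by
        rw [hw, ew]; exact div_ne_zero (by simp) y0
      rw [pointOf, zwPoint, dif_neg w0]
      simp only [hw, ew, ez]
      congr 1 <;> field_simp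

end Reduction

/-! ### The formal points as a topological group -/

section FormalGroup

variable {p : ℕ} [Fact p.Prime] {K : Type*} [NormedField K] [NormedAlgebra ℚ_[p] K]
  {W : WeierstrassCurve (padicIntegers p K)} {r : ℝ}
  [FiniteDimensional ℚ_[p] K] [DecidableEq K] [(W.baseChange K).IsElliptic]

/-- The bijection between the formal points and the points with nonsingular reduction. -/
def formalPointsHomeomorph (B : W.CoeffBound r) : W.FormalPoints ≃ₜ goodPoints B :=
  goodPointsHomeomorph B

/-- The group structure on the formal points. -/
abbrev formalPointsAddCommGroup (B : W.CoeffBound r) : AddCommGroup W.FormalPoints :=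
  (formalPointsHomeomorph B).toEquiv.addCommGroup

/-- The identity map from the formal points to the ring of integers. -/
def formalPointsValHomeomorph (W : WeierstrassCurve (padicIntegers p K)) :
    W.FormalPoints ≃ₜ padicIntegers p K :=
  Homeomorph.refl (padicIntegers p K)

/-- The group structure is transported from the curve, so its axioms need no proof; what remains is
that its addition is the value of F. -/
theorem val_add (B : W.CoeffBound r) (u v : W.FormalPoints) :
    letI := formalPointsAddCommGroup B
    (u + v).val = W.addVal u.val v.val := by
  let _ := formalPointsAddCommGroup B
  have h : formalPointsHomeomorph B (u + v) =
      formalPointsHomeomorph B u + formalPointsHomeomorph B v :=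
    (formalPointsHomeomorph B).apply_symm_apply _
  exact pointOf_injective B ((congrArg Subtype.val h).trans (pointOf_add B u.val v.val))

theorem val_zero (B : W.CoeffBound r) :
    letI := formalPointsAddCommGroup B
    (0 : W.FormalPoints).val = 0 := by
  let _ := formalPointsAddCommGroup B
  have h : formalPointsHomeomorph B 0 = 0 := (formalPointsHomeomorph B).apply_symm_apply _
  exact pointOf_injective B ((congrArg Subtype.val h).trans (pointOf_zero B).symm)

omit [DecidableEq K] [(W.baseChange K).IsElliptic] in
theorem CoeffBound.neg_denom_ne_zero (B : W.CoeffBound r) (z : padicIntegers p K) :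
    1 - W.a₁ * z - W.a₃ * W.wVal z ≠ 0 := by
  intro h
  obtain ⟨n, hn, -⟩ := B.exists_neg z
  rw [h, mul_zero, eq_comm, neg_eq_zero] at hn
  rw [hn, B.wVal_zero] at h
  simp at h

theorem val_neg (B : W.CoeffBound r) (u : W.FormalPoints) :
    letI := formalPointsAddCommGroup B
    (((-u).val : padicIntegers p K) : K) =
      -(u.val : K) / ((1 - W.a₁ * u.val - W.a₃ * W.wVal u.val : padicIntegers p K) : K) := by
  let _ := formalPointsAddCommGroup B
  have h : formalPointsHomeomorph B (-u) = -formalPointsHomeomorph B u :=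
    (formalPointsHomeomorph B).apply_symm_apply _
  obtain ⟨n, hn, hwn⟩ := B.exists_neg u.val
  have e : (-u).val = n := pointOf_injective B
    ((congrArg Subtype.val h).trans (pointOf_neg B hn hwn).symm)
  have := congrArg (Subtype.val : padicIntegers p K → K) hn
  rw [e, eq_div_iff (mt (fun h => Subtype.ext h) (B.neg_denom_ne_zero u.val))]
  exact this

theorem isTopologicalAddGroup_formalPoints (B : W.CoeffBound r) :
    letI := formalPointsAddCommGroup B
    IsTopologicalAddGroup W.FormalPoints := by
  let _ := formalPointsAddCommGroup B
  refine { continuous_add := ?_, continuous_neg := ?_ }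
  · have h := B.formalGroupLaw.continuous_evalAt B.pos B.lt_one B.norm_le_one
    exact h.congr fun x => (val_add B x.1 x.2).symm
  · have hv : Continuous (FormalPoints.val (W := W)) := continuous_id
    refine continuous_induced_rng.2 (Continuous.congr (f := fun u : W.FormalPoints =>
      -(u.val : K) / ((1 - W.a₁ * u.val - W.a₃ * W.wVal u.val : padicIntegers p K) : K)) ?_
      fun u => (val_neg B u).symm)
    refine (continuous_subtype_val.comp hv).neg.div (continuous_subtype_val.comp ?_) fun u => ?_
    · exact (continuous_const.sub (continuous_const.mul hv)).sub
        (continuous_const.mul (B.continuous_wVal.comp hv))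
    · exact mt (fun h => Subtype.ext h) (B.neg_denom_ne_zero u.val)

/-- The parameter `-x/y` as an isomorphism of topological groups. -/
def goodPointsEquiv (B : W.CoeffBound r) :
    letI := formalPointsAddCommGroup B
    goodPoints B ≃ₜ+ W.FormalPoints :=
  letI := formalPointsAddCommGroup B
  { (formalPointsHomeomorph B).symm with
    map_add' := fun P Q => (formalPointsHomeomorph B).injective (by
      refine ((formalPointsHomeomorph B).apply_symm_apply _).trans
        (Eq.trans ?_ ((formalPointsHomeomorph B).apply_symm_apply _).symm)
      exact congrArg₂ (· + ·) ((formalPointsHomeomorph B).apply_symm_apply P).symm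
        ((formalPointsHomeomorph B).apply_symm_apply Q).symm) }

theorem goodPointsEquiv_val (B : W.CoeffBound r) (P : goodPoints B) :
    letI := formalPointsAddCommGroup B
    ((goodPointsEquiv B P).val : K) = zParam P.1 := by
  obtain ⟨u, rfl⟩ := (formalPointsHomeomorph B).surjective P
  refine Eq.trans ?_ (zParam_pointOf B u.val).symm
  exact congrArg (fun x : W.FormalPoints => (x.val : K))
    ((formalPointsHomeomorph B).symm_apply_apply u)

theorem isTopologicalAddGroup_goodPoints (B : W.CoeffBound r) :
    IsTopologicalAddGroup (goodPoints B) := by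
  let _ := formalPointsAddCommGroup B
  have := isTopologicalAddGroup_formalPoints B
  exact (goodPointsEquiv B).toHomeomorph.isInducing.topologicalAddGroup
    (goodPointsEquiv B).toAddEquiv

end FormalGroup

end WeierstrassCurve

end

noncomputable section

open MvPowerSeries Filter Topology

/-! ### Gauss-norm estimates for polynomials -/

section PolynomialBound

variable {R : Type*} [NormedCommRing R]

/-- The coefficient of `Xⁿ` has norm at most `c * r ^ n`. -/
def Polynomial.CoeffLe (r c : ℝ) (q : Polynomial R) : Prop := ∀ n, ‖q.coeff n‖ ≤ c * r ^ n

namespace Polynomial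

variable {r c d : ℝ} {f g : Polynomial R}

theorem CoeffLe.mono (h0 : 0 < r) (h : CoeffLe r c f) (hcd : c ≤ d) : CoeffLe r d f := fun n =>
  (h n).trans (by gcongr)

variable [IsUltrametricDist R]

theorem CoeffLe.add (hf : CoeffLe r c f) (hg : CoeffLe r c g) : CoeffLe r c (f + g) := fun n => by
  rw [coeff_add]
  exact (IsUltrametricDist.norm_add_le_max _ _).trans (max_le (hf n) (hg n))

theorem CoeffLe.mul (h0 : 0 < r) (hc : 0 ≤ c) (hd : 0 ≤ d) (hf : CoeffLe r c f)
    (hg : CoeffLe r d g) : CoeffLe r (c * d) (f * g) := fun n => by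
  rw [coeff_mul]
  refine IsUltrametricDist.norm_sum_le_of_forall_le_of_nonneg (by positivity) fun x hx => ?_
  rw [Finset.HasAntidiagonal.mem_antidiagonal] at hx
  calc _ ≤ ‖f.coeff x.1‖ * ‖g.coeff x.2‖ := norm_mul_le _ _
    _ ≤ (c * r ^ x.1) * (d * r ^ x.2) := by gcongr; exacts [hf _, hg _]
    _ = _ := by rw [← hx, pow_add]; ring

omit [IsUltrametricDist R] in
theorem coeffLe_X [NormOneClass R] (h0 : 0 < r) : CoeffLe r r⁻¹ (X : Polynomial R) := fun n => by
  rw [coeff_X]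
  split_ifs with h
  · rw [← h, norm_one, pow_one, inv_mul_cancel₀ h0.ne']
  · rw [norm_zero]; positivity

/-- The bound says that the Gauss norm of radius 1/r is at most c. There X has norm 1/r and f has
norm at most τ ≤ 1/r, so replacing one factor X by f costs a ratio rτ. -/
theorem CoeffLe.X_add_pow_sub [NormOneClass R] {τ : ℝ} (h0 : 0 < r) (hτ0 : 0 ≤ τ) (hτ1 : τ ≤ r⁻¹)
    (hf : CoeffLe r τ f) (n : ℕ) : CoeffLe r (τ * r * r⁻¹ ^ n) ((X + f) ^ n - X ^ n) := by
  have hX : CoeffLe r r⁻¹ (X : Polynomial R) := coeffLe_X h0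
  have hXn (n : ℕ) : CoeffLe r (r⁻¹ ^ n) (X ^ n : Polynomial R) := by
    induction n with
    | zero =>
      intro m
      rw [pow_zero, pow_zero, coeff_one]
      split_ifs with h
      · simp [h]
      · rw [norm_zero]; positivity
    | succ n ih => rw [pow_succ, pow_succ]; exact ih.mul h0 (by positivity) (by positivity) hX
  induction n with
  | zero =>
    intro m
    rw [pow_zero, pow_zero, sub_self, coeff_zero, norm_zero]; positivity
  | succ n ih =>
    have e : (X + f) ^ (n + 1) - X ^ (n + 1) = (X + f) * ((X + f) ^ n - X ^ n) + f * X ^ n := by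
      ring
    rw [e]
    refine CoeffLe.add ?_ ?_
    · refine ((hX.add (hf.mono h0 hτ1)).mul h0 (by positivity) (by positivity) ih).mono h0 ?_
      rw [pow_succ]; exact le_of_eq (by ring)
    · refine (hf.mul h0 hτ0 (by positivity) (hXn n)).mono h0 (le_of_eq ?_)
      rw [pow_succ]; field_simp

theorem CoeffLe.comp_sub [NormOneClass R] {τ : ℝ} (h0 : 0 < r) (hτ0 : 0 ≤ τ) (hτ1 : τ ≤ r⁻¹)
    (hc : 0 ≤ c) (hf : CoeffLe r τ f) (hg : CoeffLe r c g) :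
    CoeffLe r (c * (r * τ)) (g.comp (X + f) - g) := by
  have e : g.comp (X + f) - g =
      ∑ i ∈ g.support, C (g.coeff i) * ((X + f) ^ i - X ^ i) := by
    rw [comp_eq_sum_left, sum_def]
    conv_lhs => rw [g.as_sum_support_C_mul_X_pow]
    simp only [mul_sub, Finset.sum_sub_distrib]
    rw [← g.as_sum_support_C_mul_X_pow]
  intro n
  rw [e, finsetSum_coeff]
  refine IsUltrametricDist.norm_sum_le_of_forall_le_of_nonneg (by positivity) fun i _ => ?_
  rw [coeff_C_mul]
  calc _ ≤ ‖g.coeff i‖ * ‖((X + f) ^ i - X ^ i).coeff n‖ := norm_mul_le _ _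
    _ ≤ (c * r ^ i) * (τ * r * r⁻¹ ^ i * r ^ n) := by
      gcongr
      exacts [hg i, hf.X_add_pow_sub h0 hτ0 hτ1 i n]
    _ = c * (r * τ) * r ^ n * (r * r⁻¹) ^ i := by rw [mul_pow]; ring
    _ = _ := by rw [mul_inv_cancel₀ h0.ne', one_pow, mul_one]

end Polynomial

end PolynomialBound

/-! ### Multiplication by p through forward differences -/

section FormalGroupMultiplication

variable {R G : Type*} [NormedCommRing R] [AddCommGroup G]

/-- The function `φ` is a uniform limit of polynomials in `val` with coefficients
bounded by `c * r ^ n`. -/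
def PolyApprox (val : G → R) (r c : ℝ) (φ : G → R) : Prop :=
  ∀ ε > 0, ∃ q : Polynomial R, q.CoeffLe r c ∧ ∀ u, ‖φ u - q.eval (val u)‖ ≤ ε

/-- The group law of `G` is given by a power series in the coordinate `val`. -/
structure IsFormalGroupCoord (val : G → R) (r : ℝ) (Φ : MvPowerSeries (Fin 2) R) : Prop where
  pos : 0 < r
  lt_one : r < 1
  norm_le_one : ∀ x : R, ‖x‖ ≤ 1
  weight : HasWeight r 1 Φ
  val_zero : val 0 = 0
  val_add : ∀ u v, val (u + v) = evalAt (val u) (val v) Φ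

variable {val : G → R} {r c : ℝ} {Φ : MvPowerSeries (Fin 2) R} {φ : G → R}

namespace IsFormalGroupCoord

theorem evalAt_zero (A : IsFormalGroupCoord val r Φ) (u : G) : evalAt (val u) 0 Φ = val u := by
  rw [← A.val_zero, ← A.val_add, add_zero]

variable [IsUltrametricDist R]

omit [IsUltrametricDist R] in
theorem norm_le_of_polyApprox (A : IsFormalGroupCoord val r Φ) (h : PolyApprox val r c φ) :
    ‖φ 0‖ ≤ c := by
  refine le_of_forall_pos_le_add fun ε hε => ?_
  obtain ⟨q, hq, hφ⟩ := h ε hε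
  have h1 := hφ 0
  have h2 := hq 0
  rw [A.val_zero, ← Polynomial.coeff_zero_eq_eval_zero] at h1
  rw [pow_zero, mul_one] at h2
  have := norm_add_le (φ 0 - q.coeff 0) (q.coeff 0)
  rw [sub_add_cancel] at this
  linarith

variable [CompleteSpace R]

theorem norm_val_add_sub_le (A : IsFormalGroupCoord val r Φ) (u v : G) :
    ‖val (u + v) - val u - val v‖ ≤ ‖val u‖ * ‖val v‖ := by
  have h := A.weight.norm_evalAt_mixed_le A.pos A.lt_one A.norm_le_one (val u) (val v)
  have e1 : evalAt 0 (val v) Φ = val v := by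
    conv_lhs => rw [← A.val_zero, ← A.val_add, zero_add]
  have e2 : evalAt 0 0 Φ = (0 : R) := by
    have := A.evalAt_zero 0
    rwa [A.val_zero] at this
  rw [A.evalAt_zero, e1, e2, ← A.val_add, add_zero] at h
  exact h

variable [NormOneClass R]

/-- In the coordinate, translation by t is X + P up to ε, with the coefficients of P bounded by ‖t‖
r ^ n. By the Gauss-norm estimate each difference gains a factor r‖t‖. -/
theorem polyApprox_fwdDiff (A : IsFormalGroupCoord val r Φ) (hc : 0 ≤ c)
    (h : PolyApprox val r c φ) (t : G) : PolyApprox val r (c * (r * ‖val t‖)) ((fwdDiff t) φ) := by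
  intro ε hε
  obtain ⟨q, hq, hφ⟩ := h ε hε
  obtain ⟨P, hP, hPe⟩ := A.weight.exists_polynomial A.pos A.lt_one A.norm_le_one (val t) hε
  refine ⟨q.comp (Polynomial.X + P) - q, Polynomial.CoeffLe.comp_sub (f := P) A.pos
    (norm_nonneg _) ((A.norm_le_one _).trans ((one_le_inv₀ A.pos).2 A.lt_one.le)) hc hP hq, fun u => ?_⟩
  have h1 := hPe (val u)
  rw [A.evalAt_zero, ← A.val_add] at h1
  rw [fwdDiff, Polynomial.eval_sub, Polynomial.eval_comp, Polynomial.eval_add, Polynomial.eval_X]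
  -- Polynomials over a ring of norm at most 1 are 1-Lipschitz, because a - b divides q(a) - q(b).
  have h2 : ‖q.eval (val (u + t)) - q.eval (val u + P.eval (val u))‖ ≤ ε := by
    obtain ⟨y, hy⟩ := Polynomial.sub_dvd_eval_sub (val (u + t)) (val u + P.eval (val u)) q
    rw [hy]
    refine (norm_mul_le_left A.norm_le_one _ _).trans ?_
    rwa [← sub_sub]
  have e : φ (u + t) - φ u - (q.eval (val u + P.eval (val u)) - q.eval (val u)) =
      (φ (u + t) - q.eval (val (u + t)) - (φ u - q.eval (val u))) +
      (q.eval (val (u + t)) - q.eval (val u + P.eval (val u))) := by ring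
  rw [e]
  refine (IsUltrametricDist.norm_add_le_max _ _).trans (max_le ?_ h2)
  rw [sub_eq_add_neg]
  refine (IsUltrametricDist.norm_add_le_max _ _).trans (max_le (hφ _) ?_)
  rw [norm_neg]; exact hφ _

theorem polyApprox_fwdDiff_iter (A : IsFormalGroupCoord val r Φ) (t : G) (k : ℕ) :
    PolyApprox val r (r⁻¹ * (r * ‖val t‖) ^ k) ((fwdDiff t)^[k] val) := by
  have := A.pos
  induction k with
  | zero =>
    intro ε hε
    refine ⟨Polynomial.X, ?_, fun u => ?_⟩
    · simpa using Polynomial.coeffLe_X A.pos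
    · simpa using hε.le
  | succ k ih =>
    rw [Function.iterate_succ_apply', pow_succ, ← mul_assoc]
    exact A.polyApprox_fwdDiff (by positivity) ih t

theorem norm_fwdDiff_iter_le (A : IsFormalGroupCoord val r Φ) (t : G) (k : ℕ) :
    ‖(fwdDiff t)^[k + 1] val 0‖ ≤ r ^ k * ‖val t‖ ^ (k + 1) := by
  refine (A.norm_le_of_polyApprox (A.polyApprox_fwdDiff_iter t (k + 1))).trans (le_of_eq ?_)
  have := A.pos
  rw [mul_pow, pow_succ r]
  field_simp

/-- Multiplication by a prime `p` on a formal group is multiplication by `p` in the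
coordinate, up to a smaller error. -/
theorem norm_val_nsmul_sub_le (A : IsFormalGroupCoord val r Φ) {p : ℕ} (hp : p.Prime) (t : G) :
    ‖val (p • t) - p * val t‖ ≤ max (‖(p : R)‖ * r) (r ^ (p - 1)) * ‖val t‖ ^ 2 := by
  have h0 := A.pos
  have h1 := A.lt_one
  have hle := A.norm_le_one (val t)
  obtain ⟨n, rfl⟩ := Nat.exists_eq_add_of_le' hp.two_le
  -- Newton's formula for val(p • t), with p = n + 2. The order 0 term is val 0 = 0 and the order 1
  -- term is p val(t); index k in the remaining sum stands for order k + 2.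
  have h := shift_eq_sum_fwdDiff_iter t val (n + 2) 0
  rw [zero_add, Finset.sum_range_succ', Finset.sum_range_succ'] at h
  simp only [zero_add, Function.iterate_one, fwdDiff, Function.iterate_zero, id_eq, A.val_zero,
    sub_zero, smul_zero, add_zero, Nat.choose_one_right, nsmul_eq_mul] at h
  rw [h, add_sub_cancel_right]
  refine IsUltrametricDist.norm_sum_le_of_forall_le_of_nonneg (by positivity) fun k hk => ?_
  have hd := A.norm_fwdDiff_iter_le t (k + 1)
  have hpow : ‖val t‖ ^ (k + 1 + 1) ≤ ‖val t‖ ^ 2 :=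
    pow_le_pow_of_le_one (norm_nonneg _) hle (by omega)
  refine (norm_mul_le _ _).trans ?_
  -- Order p has binomial coefficient 1 and relies on r ^ (p - 1); for the lower orders p divides
  -- the binomial coefficient.
  rcases eq_or_ne k n with rfl | hkn
  · rw [Nat.choose_self, Nat.cast_one]
    calc _ ≤ 1 * (r ^ (k + 1) * ‖val t‖ ^ 2) := by
          gcongr
          · exact A.norm_le_one 1
          · exact hd.trans (by gcongr)
      _ = r ^ (k + 2 - 1) * ‖val t‖ ^ 2 := by rw [one_mul]; rfl
      _ ≤ _ := by gcongr; exact le_max_right _ _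
  · have hdvd : (n + 2) ∣ (n + 2).choose (k + 1 + 1) :=
      hp.dvd_choose_self (by omega) (by rw [Finset.mem_range] at hk; omega)
    have hch : ‖(((n + 2).choose (k + 1 + 1) : ℕ) : R)‖ ≤ ‖((n + 2 : ℕ) : R)‖ := by
      obtain ⟨m, hm⟩ := hdvd
      rw [hm, Nat.cast_mul]
      exact norm_mul_le_left A.norm_le_one _ _
    calc _ ≤ ‖((n + 2 : ℕ) : R)‖ * (r * ‖val t‖ ^ 2) := by
          gcongr
          refine hd.trans ?_
          gcongr
          exact pow_le_of_le_one h0.le h1.le (by omega)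
      _ = ‖((n + 2 : ℕ) : R)‖ * r * ‖val t‖ ^ 2 := by ring
      _ ≤ _ := by gcongr; exact le_max_left _ _

end IsFormalGroupCoord

end FormalGroupMultiplication

end

noncomputable section

open Filter Topology

namespace IsFormalGroupCoord

/-! ### The logarithm as the limit of [pⁿ](u) / pⁿ -/

section Logarithm

variable {p : ℕ} [Fact p.Prime] {K : Type*} [NormedField K] [NormedAlgebra ℚ_[p] K]
  [FiniteDimensional ℚ_[p] K] {G : Type*} [AddCommGroup G] {val : G → padicIntegers p K} {r : ℝ}
  {Φ : MvPowerSeries (Fin 2) (padicIntegers p K)} (A : IsFormalGroupCoord val r Φ)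
include A

theorem exists_norm_val_nsmul_sub_le (hr : r ^ (p - 1) < (p : ℝ)⁻¹) :
    ∃ θ, 0 ≤ θ ∧ θ < 1 ∧ ∀ t, ‖val (p • t) - p * val t‖ ≤ θ * (p : ℝ)⁻¹ * ‖val t‖ ^ 2 := by
  have hp := (Fact.out : p.Prime)
  have hp0 : (0 : ℝ) < p := by exact_mod_cast hp.pos
  have h0 := A.pos
  -- The two entries are the errors of the orders below p and of order p, relative to |p|; the
  -- hypothesis on r makes the second less than 1.
  refine ⟨max r (r ^ (p - 1) * p), by positivity, max_lt A.lt_one ?_, fun t => ?_⟩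
  · rwa [← lt_div_iff₀ hp0, one_div]
  · refine (A.norm_val_nsmul_sub_le hp t).trans (le_of_eq ?_)
    rw [padicIntegers.norm_p, max_mul_of_nonneg _ _ (by positivity : 0 ≤ (p : ℝ)⁻¹), mul_comm r,
      mul_assoc _ (p : ℝ), mul_inv_cancel₀ hp0.ne', mul_one]

/-- The approximation `[pⁿ](u) / pⁿ` to the logarithm. -/
def logSeq (_ : IsFormalGroupCoord val r Φ) (u : G) (n : ℕ) : K :=
  (val (p ^ n • u) : K) / (p : K) ^ n

/-- Multiplication by p shrinks the coordinate by 1/p while its error is quadratic, so successive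
quotients differ by at most θ‖u‖p⁻ⁿ. The ultrametric inequality bounds the total deviation by θ‖u‖,
the largest of these steps. -/
theorem exists_log (hr : r ^ (p - 1) < (p : ℝ)⁻¹) : ∃ θ, θ < 1 ∧
    ∃ L : G →+ padicIntegers p K, ∀ u, ‖L u - val u‖ ≤ θ * ‖val u‖ := by
  have hp := (Fact.out : p.Prime)
  have hp1 : (1 : ℝ) < p := by exact_mod_cast hp.one_lt
  have hq0 : 0 < (p : ℝ)⁻¹ := by positivity
  have hq1 : (p : ℝ)⁻¹ < 1 := inv_lt_one_of_one_lt₀ hp1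
  have hpK : (p : K) ≠ 0 := by
    rw [← norm_ne_zero_iff, padicIntegers.norm_coe_p]; exact hq0.ne'
  have := padicIntegers.isUltrametricDist_field p K
  have := padicIntegers.properSpace p K
  obtain ⟨θ, hθ0, hθ1, hθ⟩ := A.exists_norm_val_nsmul_sub_le hr
  refine ⟨θ, hθ1, ?_⟩
  have hle (u : G) := padicIntegers.norm_le_one (val u)
  have hval (u : G) (n : ℕ) : ‖val (p ^ n • u)‖ ≤ (p : ℝ)⁻¹ ^ n * ‖val u‖ := by
    induction n with
    | zero => simp
    | succ n ih =>
      set x := p ^ n • u with hx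
      have hxs : p ^ (n + 1) • u = p • x := by rw [hx, pow_succ', mul_smul]
      rw [hxs]
      have h1 : ‖val (p • x)‖ ≤ (p : ℝ)⁻¹ * ‖val x‖ := by
        have e : val (p • x) = (val (p • x) - p * val x) + p * val x := by ring
        rw [e]
        refine (IsUltrametricDist.norm_add_le_max _ _).trans (max_le ((hθ x).trans ?_) ?_)
        · have : ‖val x‖ ^ 2 ≤ ‖val x‖ := pow_le_of_le_one (norm_nonneg _) (hle x) two_ne_zero
          calc θ * (p : ℝ)⁻¹ * ‖val x‖ ^ 2 ≤ 1 * (p : ℝ)⁻¹ * ‖val x‖ := by gcongr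
            _ = _ := by ring
        · rw [norm_mul, padicIntegers.norm_p]
      calc _ ≤ _ := h1
        _ ≤ (p : ℝ)⁻¹ * ((p : ℝ)⁻¹ ^ n * ‖val u‖) := by gcongr
        _ = _ := by ring
  have hstep (u : G) (n : ℕ) :
      ‖A.logSeq u (n + 1) - A.logSeq u n‖ ≤ θ * ‖val u‖ * (p : ℝ)⁻¹ ^ n := by
    set x := p ^ n • u with hx
    have hxs : p ^ (n + 1) • u = p • x := by rw [hx, pow_succ', mul_smul]
    have e : A.logSeq u (n + 1) - A.logSeq u n =
        ((val (p • x) - p * val x : padicIntegers p K) : K) / (p : K) ^ (n + 1) := by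
      rw [logSeq, logSeq, hxs, ← hx]
      push_cast
      field_simp
      ring
    rw [e, norm_div, norm_pow, padicIntegers.norm_coe_p, div_le_iff₀ (by positivity)]
    refine (hθ x).trans ?_
    have h2 := hval u n
    have h3 : ‖val u‖ ^ 2 ≤ ‖val u‖ := pow_le_of_le_one (norm_nonneg _) (hle u) two_ne_zero
    calc θ * (p : ℝ)⁻¹ * ‖val x‖ ^ 2 ≤ θ * (p : ℝ)⁻¹ * ((p : ℝ)⁻¹ ^ n * ‖val u‖) ^ 2 := by
          gcongr
      _ = θ * (p : ℝ)⁻¹ * ((p : ℝ)⁻¹ ^ n) ^ 2 * ‖val u‖ ^ 2 := by ring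
      _ ≤ θ * (p : ℝ)⁻¹ * ((p : ℝ)⁻¹ ^ n) ^ 2 * ‖val u‖ := by gcongr
      _ = _ := by ring
  have hconv (u : G) : ∃ l : K, Tendsto (A.logSeq u) atTop (𝓝 l) := by
    refine cauchySeq_tendsto_of_complete (cauchySeq_of_le_geometric _ (θ * ‖val u‖) hq1 fun n => ?_)
    rw [dist_comm, dist_eq_norm]
    exact hstep u n
  choose l hl using hconv
  have hclose (u : G) (n : ℕ) : ‖A.logSeq u n - val u‖ ≤ θ * ‖val u‖ := by
    induction n with
    | zero =>
      have : A.logSeq u 0 = val u := by simp [logSeq]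
      rw [this, sub_self, norm_zero]; positivity
    | succ n ih =>
      have e : A.logSeq u (n + 1) - val u =
          (A.logSeq u (n + 1) - A.logSeq u n) + (A.logSeq u n - val u) := by ring
      rw [e]
      refine (IsUltrametricDist.norm_add_le_max _ _).trans (max_le ((hstep u n).trans ?_) ih)
      exact mul_le_of_le_one_right (by positivity) (pow_le_one₀ hq0.le hq1.le)
  have hlclose (u : G) : ‖l u - val u‖ ≤ θ * ‖val u‖ :=
    le_of_tendsto ((hl u).sub_const _).norm (Eventually.of_forall (hclose u))
  have hl1 (u : G) : ‖l u‖ ≤ 1 := by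
    have e : l u = (l u - val u) + val u := by ring
    rw [e]
    refine (IsUltrametricDist.norm_add_le_max _ _).trans (max_le ((hlclose u).trans ?_) (hle u))
    exact mul_le_one₀ hθ1.le (norm_nonneg _) (hle u)
  -- The additivity defect of val at level n is at most p⁻²ⁿ, which after division by pⁿ still tends
  -- to 0.
  have hladd (u v : G) : l (u + v) = l u + l v := by
    have h1 : Tendsto (fun n => A.logSeq (u + v) n - A.logSeq u n - A.logSeq v n) atTop
        (𝓝 (l (u + v) - l u - l v)) := ((hl _).sub (hl _)).sub (hl _)
    have h2 : Tendsto (fun n => A.logSeq (u + v) n - A.logSeq u n - A.logSeq v n) atTop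
        (𝓝 0) := by
      refine squeeze_zero_norm (fun n => ?_) (tendsto_pow_atTop_nhds_zero_of_lt_one hq0.le hq1)
      have e : A.logSeq (u + v) n - A.logSeq u n - A.logSeq v n =
          ((val (p ^ n • u + p ^ n • v) - val (p ^ n • u) - val (p ^ n • v) :
            padicIntegers p K) : K) / (p : K) ^ n := by
        rw [logSeq, logSeq, logSeq, smul_add]
        push_cast
        ring
      rw [e, norm_div, norm_pow, padicIntegers.norm_coe_p, div_le_iff₀ (by positivity)]
      refine (A.norm_val_add_sub_le _ _).trans ?_
      gcongr
      · exact (hval u n).trans (mul_le_of_le_one_right (by positivity) (hle u))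
      · exact (hval v n).trans (mul_le_of_le_one_right (by positivity) (hle v))
    have := tendsto_nhds_unique h1 h2
    linear_combination this
  exact ⟨AddMonoidHom.mk' (fun u => (⟨l u, hl1 u⟩ : padicIntegers p K))
    fun u v => Subtype.ext (hladd u v), fun u => hlclose u⟩

/-- L differs from the coordinate by a relative error θ < 1, so L u = 0 forces val u = 0. A
continuous bijection from a compact to a Hausdorff space is a homeomorphism. -/
theorem nonempty_continuousAddEquiv [TopologicalSpace G] [IsTopologicalAddGroup G]
    (e : G ≃ₜ padicIntegers p K) (he : ∀ u, e u = val u) (hr : r ^ (p - 1) < (p : ℝ)⁻¹) :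
    Nonempty (G ≃ₜ+ padicIntegers p K) := by
  obtain ⟨θ, hθ1, L, hL⟩ := A.exists_log hr
  have hLle (u : G) : ‖L u‖ ≤ ‖val u‖ := by
    have e : L u = (L u - val u) + val u := by ring
    rw [e]
    refine (IsUltrametricDist.norm_add_le_max _ _).trans (max_le ((hL u).trans ?_) le_rfl)
    exact mul_le_of_le_one_left (norm_nonneg _) hθ1.le
  have hcont : Continuous L := by
    refine continuous_of_continuousAt_zero L ?_
    rw [ContinuousAt, map_zero]
    refine squeeze_zero_norm (fun u => hLle u) ?_
    have h : Continuous fun u => ‖val u‖ := by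
      simp only [← he]; exact continuous_norm.comp e.continuous
    simpa [A.val_zero] using h.tendsto 0
  have hval0 (u : G) (h : val u = 0) : u = 0 := e.injective (by rw [he, he, h, A.val_zero])
  have hsmall (u : G) (h : ‖val u‖ ≤ θ * ‖val u‖) : val u = 0 := by
    have := norm_nonneg (val u)
    exact norm_eq_zero.1 (by nlinarith)
  have hinj : Function.Injective L := by
    rw [injective_iff_map_eq_zero]
    intro u hu
    refine hval0 u (hsmall u ?_)
    simpa [hu] using hL u
  have : CompactSpace G := e.symm.compactSpace
  have hsurj : Function.Surjective L := by
    intro s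
    -- Take u with L u closest to s. Adding the element d with coordinate s - L u would shrink the
    -- distance by θ, so the minimal distance is 0.
    obtain ⟨u, -, hu⟩ := isCompact_univ.exists_isMinOn (Set.univ_nonempty (α := G))
      (f := fun u => ‖s - L u‖) (continuous_const.sub hcont).norm.continuousOn
    refine ⟨u, ?_⟩
    set d := e.symm (s - L u) with hd
    have hvd : val d = s - L u := by rw [← he, hd, e.apply_symm_apply]
    have h1 : ‖s - L u‖ ≤ ‖s - L (u + d)‖ := hu (Set.mem_univ _)
    have h2 : s - L (u + d) = -(L d - val d) := by rw [map_add, hvd]; ring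
    rw [h2, norm_neg, ← hvd] at h1
    have := hsmall d (h1.trans (hL d))
    rw [hvd, sub_eq_zero] at this
    exact this.symm
  let E : G ≃+ padicIntegers p K := AddEquiv.ofBijective L ⟨hinj, hsurj⟩
  have hE : Continuous E.toEquiv := hcont
  exact ⟨{ E with
    continuous_toFun := hcont
    continuous_invFun := (Continuous.homeoOfEquivCompactToT2 hE).continuous_invFun }⟩

end Logarithm

end IsFormalGroupCoord

end

/-! ### Assembly of the theorem -/

theorem mainTheorem2 (p : ℕ) [Fact p.Prime] (K : Type*) [NormedField K] [NormedAlgebra ℚ_[p] K]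
    [FiniteDimensional ℚ_[p] K] [DecidableEq K]
    (W : WeierstrassCurve (padicIntegers p K)) [(W.baseChange K).IsElliptic]
    (h₁ : W.a₁ ∈ IsLocalRing.maximalIdeal (padicIntegers p K))
    (h₂ : W.a₂ ∈ IsLocalRing.maximalIdeal (padicIntegers p K))
    (h₃ : W.a₃ ∈ IsLocalRing.maximalIdeal (padicIntegers p K))
    (h₄ : W.a₄ ∈ IsLocalRing.maximalIdeal (padicIntegers p K))
    (h₆ : W.a₆ ∈ IsLocalRing.maximalIdeal (padicIntegers p K)) :
    ∃ E₀ : AddSubgroup (W.baseChange K).toAffine.Point,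
      (E₀ : Set (W.baseChange K).toAffine.Point) = W.nonsingularReduction K ∧
      IsTopologicalAddGroup E₀ ∧
      (∃ _ : AddCommGroup W.FormalPoints,
        (∀ u v : W.FormalPoints, HasSum (W.formalGroupTerms u.val v.val) (u + v).val) ∧
        IsTopologicalAddGroup W.FormalPoints ∧
        (∀ (x y : K) (h : (W.baseChange K).toAffine.Nonsingular x y),
          WeierstrassCurve.Affine.Point.some x y h ∈ E₀ → y ≠ 0) ∧
        ∃ Ψ : E₀ ≃ₜ+ W.FormalPoints,
          ∀ P : E₀, ((Ψ P).val : K) = WeierstrassCurve.zParam P.1) ∧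
      (6 * padicRamificationIdx p K < p - 1 → Nonempty (E₀ ≃ₜ+ padicIntegers p K)) := by
  obtain ⟨r, B, hr⟩ := padicIntegers.exists_coeffBound W h₁ h₂ h₃ h₄ h₆
  let _ := WeierstrassCurve.formalPointsAddCommGroup B
  have htop := WeierstrassCurve.isTopologicalAddGroup_formalPoints B
  have hsum (u v : padicIntegers p K) : HasSum (W.formalGroupTerms u v) (W.addVal u v) :=
    (B.formalGroupLaw.summable B.pos B.lt_one B.norm_le_one u v).hasSum
  refine ⟨WeierstrassCurve.goodPoints B, WeierstrassCurve.coe_goodPoints B,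
    WeierstrassCurve.isTopologicalAddGroup_goodPoints B,
    ⟨WeierstrassCurve.formalPointsAddCommGroup B, fun u v => ?_, htop, ?_,
      WeierstrassCurve.goodPointsEquiv B, WeierstrassCurve.goodPointsEquiv_val B⟩, fun he => ?_⟩
  · rw [WeierstrassCurve.val_add B]
    exact hsum u.val v.val
  · rintro x y h ⟨z, hz⟩
    have := WeierstrassCurve.pointCoords_pointOf_ne_zero B z
    rw [hz] at this
    exact this
  · have A : IsFormalGroupCoord (WeierstrassCurve.FormalPoints.val (W := W)) r W.formalGroupLaw :=
      ⟨B.pos, B.lt_one, B.norm_le_one, B.formalGroupLaw, WeierstrassCurve.val_zero B,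
        WeierstrassCurve.val_add B⟩
    obtain ⟨f⟩ := A.nonempty_continuousAddEquiv (WeierstrassCurve.formalPointsValHomeomorph W)
      (fun _ => rfl) (hr he)
    exact ⟨(WeierstrassCurve.goodPointsEquiv B).trans f⟩
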